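/- Let $(M,\mathtt g)$ be a compact connected Riemannian manifold on which a compact Lie group $\mathsf G$ acts smoothly, isometrically and almost effectively (the ineffective kernel is finite), with orbit space $M/\mathsf G$ homeomorphic to $[-1,1]$. Let $\gamma$ be a geodesic, parametrized by arc length and perpendicular to all orbits that it meets, such that the orbit $S=\mathsf G\cdot\gamma(0)=\mathsf G/\mathsf K$, $\mathsf K=\mathsf G_{\gamma(0)}$, is singular, and such that for $0<t<L$ the isotropy group $\mathsf G_{\gamma(t)}$ is a fixed group $\mathsf H\subset\mathsf K$, with $\dim\mathsf G/\mathsf K<\dim\mathsf G/\mathsf H=\dim M-1$. For $0<t<L$ let $\mathtt g_t$ be the metric on $\mathsf G/\mathsf H$ induced by $\mathtt g$ through $x_t\colon\mathsf G/\mathsf H\to M$, $a\mathsf H\mapsto a\cdot\gamma(t)$, let $S=\mathsf G/\mathsf K$ carry the metric induced by $\mathtt g$, and let $q\colon\mathsf G/\mathsf H\to\mathsf G/\mathsf K$, $q(a\mathsf H)=a\mathsf K$. Let $\mathfrak m$ be an $\mathrm{Ad}(\mathsf K)$-invariant complement of $\mathfrak k$ in $\mathfrak g$, and $\mathfrak p$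 an $\mathrm{Ad}(\mathsf H)$-invariant complement of $\mathfrak h$ in $\mathfrak k$. Suppose that $\mathtt g$ is adapted near $S$: there are $\varepsilon>0$ and a smooth positive function $\alpha$ on $(0,\varepsilon)$ with $\lim_{t\to0}\alpha(t)=1$ such that for $0<t<\varepsilon$ the inner product on $\mathfrak m\oplus\mathfrak p$ that determines $\mathtt g_t$ is $\alpha(t)^2A+B_t$, where $A$ is the inner product on $\mathfrak m$ that determines the metric of $S$, and $B_t$ is an inner product on $\mathfrak p$. Let $\Delta_t$ and $\Delta_S$ denote the self-adjoint extensions, on real $L^2$ functions, of the Laplacians of $(\mathsf G/\mathsf H,\mathtt g_t)$ and of $S$. Then there is $\delta>0$ such that for all $0<t<\delta$ and every function $f$ on $\mathsf G/\mathsf H$: $f$ is an eigenfunction of $\Delta_t$ that is constant along the fibers of $q$ if and only if $f$ is the lift $\psi\circ q$ of an eigenfunction $\psi$ of $\Delta_S$. (As usual for $L^2$ functions, being constant along the fibers and being a lift are understood up to modification on a null set.) In particular, an eigenfunction of $\Delta_t$ is constant along the fibers of $q$ if and only if it is the lift of an eigenfunction of $\Delta_S$. -/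

import Mathlib

open Set Filter MeasureTheory Topology
open scoped Manifold ContDiff ENNReal

noncomputable section

/-! ### Laplacian of a closed Riemannian manifold -/

/-- Smooth Riemannian metrics on an `n`-dimensional smooth manifold `N` without boundary. -/
abbrev SmoothMetric (n : ℕ) (N : Type*) [TopologicalSpace N]
    [ChartedSpace (EuclideanSpace ℝ (Fin n)) N] [IsManifold (𝓡 n) ∞ N] :=
  Bundle.ContMDiffRiemannianMetric (𝓡 n) ∞ (EuclideanSpace ℝ (Fin n))
    (fun x : N => TangentSpace (𝓡 n) x)

section Laplacian

variable {n : ℕ} {N : Type*} [TopologicalSpace N]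
  [ChartedSpace (EuclideanSpace ℝ (Fin n)) N] [IsManifold (𝓡 n) ∞ N]

/-- The volume density `√ det (g (∂ᵢ, ∂ⱼ))` in the preferred chart at `x`, at the point with
coordinates `y`. -/
def volumeDensity (g : SmoothMetric n N) (x : N) (y : EuclideanSpace ℝ (Fin n)) : ℝ :=
  let c := chartAt (EuclideanSpace ℝ (Fin n)) x
  let coordVec : Fin n → TangentSpace (𝓡 n) (c.symm y) := fun i =>
    mfderiv (𝓡 n) (𝓡 n) c.symm y (EuclideanSpace.single i (1 : ℝ))
  Real.sqrt (Matrix.det (Matrix.of fun i j => g.inner (c.symm y) (coordVec i) (coordVec j)))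

/-- The part of the Riemannian volume that lives on the domain of the preferred chart at `x`:
the measure `√ det (gᵢⱼ) dy¹ … dyⁿ`, transported from the chart to `N`. -/
def chartVolume [MeasurableSpace N] (g : SmoothMetric n N) (x : N) : Measure N :=
  ((volume.restrict (chartAt (EuclideanSpace ℝ (Fin n)) x).target).withDensity
    (fun y => ENNReal.ofReal (volumeDensity g x y))).map
      (chartAt (EuclideanSpace ℝ (Fin n)) x).symm

/-- The Riemannian volume measure. The measures `chartVolume g x` agree on the overlaps of the
charts, so that (on a second countable manifold) the smallest measure above all of them is the
measure which is given by `√ det (gᵢⱼ) dy¹ … dyⁿ` in every chart. -/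
def riemannianVolume [MeasurableSpace N] (g : SmoothMetric n N) : Measure N :=
  ⨆ x : N, chartVolume g x

/-- The differential of a real function at `x`, applied to a tangent vector. -/
def differential (φ : N → ℝ) (x : N) (v : TangentSpace (𝓡 n) x) : ℝ :=
  mfderiv (𝓡 n) 𝓘(ℝ, ℝ) φ x v

/-- `V` is the gradient of `φ`: `g (V, v) = dφ (v)` for all tangent vectors `v`. -/
def IsGradient (g : SmoothMetric n N) (φ : N → ℝ) (V : ∀ x : N, TangentSpace (𝓡 n) x) : Prop :=
  ∀ (x : N) (v : TangentSpace (𝓡 n) x), g.inner x (V x) v = differential φ x v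

/-- `h = Δ φ` for smooth functions `φ`, `h` on a closed manifold, where `Δ = - div grad`. The
divergence of the gradient field is taken in the sense of Green's identity
`∫ (Δ φ) χ = ∫ g (grad φ, grad χ) = ∫ dχ (grad φ)`, for all smooth functions `χ`. -/
def IsLaplacian [MeasurableSpace N] (g : SmoothMetric n N) (φ h : N → ℝ) : Prop :=
  ContMDiff (𝓡 n) 𝓘(ℝ, ℝ) ∞ φ ∧ ContMDiff (𝓡 n) 𝓘(ℝ, ℝ) ∞ h ∧
    ∃ V : ∀ x : N, TangentSpace (𝓡 n) x, IsGradient g φ V ∧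
      ∀ χ : N → ℝ, ContMDiff (𝓡 n) 𝓘(ℝ, ℝ) ∞ χ →
        ∫ x, h x * χ x ∂(riemannianVolume g) =
          ∫ x, differential χ x (V x) ∂(riemannianVolume g)

/-- `f` is an eigenfunction, for some real eigenvalue, of the self-adjoint extension on `L²` of the
Laplacian of the closed Riemannian manifold `(N, g)`. The Laplacian on smooth functions is
essentially self-adjoint, and its self-adjoint extension is its Hilbert space adjoint: `Δ f = lam f`
means that `⟨f, Δ φ⟩ = ⟨lam f, φ⟩` for all smooth functions `φ`. -/
def IsLaplaceEigenfunction [MeasurableSpace N] (g : SmoothMetric n N) (f : N → ℝ) : Prop :=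
  MemLp f 2 (riemannianVolume g) ∧ ¬ f =ᵐ[riemannianVolume g] 0 ∧
    ∃ lam : ℝ, ∀ φ h : N → ℝ, IsLaplacian g φ h →
      ∫ x, f x * h x ∂(riemannianVolume g) = ∫ x, lam * f x * φ x ∂(riemannianVolume g)

end Laplacian

/-! ### Homogeneous spaces and Lie algebras -/

section Homogeneous

variable {k : ℕ} {G : Type*} [Group G] [TopologicalSpace G]
  [ChartedSpace (EuclideanSpace ℝ (Fin k)) G]

/-- The smooth structure that `G ⧸ H` carries is that of the homogeneous space: the projection
`G → G ⧸ H` is a smooth submersion. -/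
def IsHomogeneousStructure (k d : ℕ) {G : Type*} [Group G] [TopologicalSpace G]
    [ChartedSpace (EuclideanSpace ℝ (Fin k)) G] (H : Subgroup G)
    [ChartedSpace (EuclideanSpace ℝ (Fin d)) (G ⧸ H)] : Prop :=
  ContMDiff (𝓡 k) (𝓡 d) ∞ (QuotientGroup.mk : G → G ⧸ H) ∧
    ∀ a : G, Function.Surjective (mfderiv (𝓡 k) (𝓡 d) (QuotientGroup.mk : G → G ⧸ H) a)

/-- The Lie algebra of the subgroup `H`, as a subspace of `𝔤 = T₁ G`: since `H` is the fibre through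
`1` of the submersion `G → G ⧸ H`, it is the kernel of the differential at `1`. -/
def subgroupLieAlgebra (k d : ℕ) {G : Type*} [Group G] [TopologicalSpace G]
    [ChartedSpace (EuclideanSpace ℝ (Fin k)) G] (H : Subgroup G)
    [ChartedSpace (EuclideanSpace ℝ (Fin d)) (G ⧸ H)] :
    Submodule ℝ (GroupLieAlgebra (𝓡 k) G) :=
  LinearMap.ker (mfderiv (𝓡 k) (𝓡 d) (QuotientGroup.mk : G → G ⧸ H) (1 : G)).toLinearMap

/-- The adjoint action of `a` on `𝔤`, the differential at `1` of the conjugation by `a`. -/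
def adjointAction (a : G) (X : GroupLieAlgebra (𝓡 k) G) : GroupLieAlgebra (𝓡 k) G :=
  (mfderiv (𝓡 k) (𝓡 k) (fun b : G => a * b * a⁻¹) (1 : G) X : EuclideanSpace ℝ (Fin k))

/-- `V` is an `Ad (H)`-invariant subspace of `𝔤`. -/
def IsAdInvariant (H : Subgroup G) (V : Submodule ℝ (GroupLieAlgebra (𝓡 k) G)) : Prop :=
  ∀ a ∈ H, ∀ X ∈ V, adjointAction a X ∈ V

end Homogeneous

/-! ### Cohomogeneity one actions -/

section CohomogeneityOne

variable {k m : ℕ} {G : Type*} [Group G] [TopologicalSpace G]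
  [ChartedSpace (EuclideanSpace ℝ (Fin k)) G]
  {M : Type*} [TopologicalSpace M] [ChartedSpace (EuclideanSpace ℝ (Fin m)) M]
  [IsManifold (𝓡 m) ∞ M] [MulAction G M]

/-- The metric `g` is `G`-invariant, i.e. `G` acts on `(M, g)` by isometries. -/
def IsInvariantMetric (G : Type*) [Group G] [MulAction G M] (g : SmoothMetric m M) : Prop :=
  ∀ (a : G) (x : M) (v w : TangentSpace (𝓡 m) x),
    g.inner (a • x) (mfderiv (𝓡 m) (𝓡 m) (fun y : M => a • y) x v)
      (mfderiv (𝓡 m) (𝓡 m) (fun y : M => a • y) x w) = g.inner x v w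

/-- The value at `x` of the action field of `X ∈ 𝔤`. -/
def actionField (X : GroupLieAlgebra (𝓡 k) G) (x : M) : TangentSpace (𝓡 m) x :=
  (mfderiv (𝓡 k) (𝓡 m) (fun a : G => a • x) (1 : G) X : EuclideanSpace ℝ (Fin m))

/-- The velocity vector at time `t` of a curve in `M`. -/
def velocity (γ : ℝ → M) (t : ℝ) : TangentSpace (𝓡 m) (γ t) :=
  mfderiv 𝓘(ℝ, ℝ) (𝓡 m) γ t (1 : ℝ)

/-- `γ` is a smooth curve of unit speed which is perpendicular to every orbit that it meets; for
an isometric action of cohomogeneity one these curves are the normal geodesics, parametrized by arc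
length. -/
def IsNormalGeodesic (k : ℕ) (G : Type*) [Group G] [TopologicalSpace G]
    [ChartedSpace (EuclideanSpace ℝ (Fin k)) G] [MulAction G M]
    (g : SmoothMetric m M) (γ : ℝ → M) : Prop :=
  ContMDiff 𝓘(ℝ, ℝ) (𝓡 m) ∞ γ ∧
    (∀ t, g.inner (γ t) (velocity γ t) (velocity γ t) = 1) ∧
    ∀ (t : ℝ) (X : GroupLieAlgebra (𝓡 k) G),
      g.inner (γ t) (velocity γ t) (actionField X (γ t)) = 0

/-- The symmetric bilinear form `⟨X, Y⟩ = g (X*, Y*)` on `𝔤` given by the action fields at `x`.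
On a complement of the isotropy algebra of `x` it is the inner product that determines the
`G`-invariant metric which the orbit of `x` inherits from `g`. -/
def orbitForm (g : SmoothMetric m M) (x : M) (X Y : GroupLieAlgebra (𝓡 k) G) : ℝ :=
  g.inner x (actionField X x) (actionField Y x)

/-- `gN` is the metric on `G ⧸ H` that is induced by `g` through the orbit `a H ↦ a • x`. It is
written after composition with the submersion `G → G ⧸ H`, through which the orbit map
`G → M`, `a ↦ a • x` factors. -/
def IsOrbitMetric (k : ℕ) {d : ℕ} {G : Type*} [Group G] [TopologicalSpace G]
    [ChartedSpace (EuclideanSpace ℝ (Fin k)) G] [MulAction G M] {H : Subgroup G}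
    [ChartedSpace (EuclideanSpace ℝ (Fin d)) (G ⧸ H)] [IsManifold (𝓡 d) ∞ (G ⧸ H)]
    (g : SmoothMetric m M) (x : M) (gN : SmoothMetric d (G ⧸ H)) : Prop :=
  ∀ (a : G) (v w : TangentSpace (𝓡 k) a),
    gN.inner (QuotientGroup.mk a)
        (mfderiv (𝓡 k) (𝓡 d) (QuotientGroup.mk : G → G ⧸ H) a v)
        (mfderiv (𝓡 k) (𝓡 d) (QuotientGroup.mk : G → G ⧸ H) a w) =
      g.inner (a • x) (mfderiv (𝓡 k) (𝓡 m) (fun b : G => b • x) a v)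
        (mfderiv (𝓡 k) (𝓡 m) (fun b : G => b • x) a w)

/-- The metric `g` is adapted near the orbit of `γ 0`: for small `t > 0` the inner product on
`𝔫 = 𝔪 ⊕ 𝔭` that determines the metric of the orbit of `γ t` is `α(t)² A + B_t`. Here `A` is the
inner product on `𝔪` that determines the metric of the orbit of `γ 0`, and `B_t`, an inner product
on `𝔭`, is necessarily the restriction to `𝔭` of the form on the left hand side. -/
def IsAdaptedNear (g : SmoothMetric m M) (γ : ℝ → M)
    (𝔪 𝔭 : Submodule ℝ (GroupLieAlgebra (𝓡 k) G)) : Prop :=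
  ∃ ε > 0, ∃ α : ℝ → ℝ, ContDiffOn ℝ ∞ α (Ioo 0 ε) ∧ (∀ t ∈ Ioo 0 ε, 0 < α t) ∧
    Tendsto α (𝓝[>] 0) (𝓝 1) ∧
    ∀ t ∈ Ioo 0 ε, ∀ X ∈ 𝔪, ∀ X' ∈ 𝔪, ∀ Y ∈ 𝔭, ∀ Y' ∈ 𝔭,
      orbitForm g (γ t) (X + Y) (X' + Y') =
        α t ^ 2 * orbitForm g (γ 0) X X' + orbitForm g (γ t) Y Y'

end CohomogeneityOne

/-- The (class of the) function `f` is constant along the fibres of `q`, up to a change of `f` on a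
null set. -/
def IsConstantAlongFibers {N S : Type*} [MeasurableSpace N] (μ : Measure N) (q : N → S)
    (f : N → ℝ) : Prop :=
  ∃ f₀ : N → ℝ, f =ᵐ[μ] f₀ ∧ ∀ x y, q x = q y → f₀ x = f₀ y

end

/-! Write C = α(t)². Both orbit metrics are G-invariant, so their volumes are constant multiples of
the images of the Haar probability measure of G (`IsOrbitMetric.exists_riemannianVolume_eq`). The
constants cancel from the integral identities that define Laplacians and eigenfunctions, so all
integrals can be computed on G. There functions on G ⧸ H and G ⧸ K become right H- and right
K-invariant functions, and q becomes measure preserving.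

In a left invariant frame an orbit metric is a constant form on 𝔤 (`IsOrbitMetric.inner_leftVec`).
Adaptedness says that for g_t the spaces 𝔪 and 𝔭 are orthogonal and that the form on 𝔪 is C·A. A
lift from G ⧸ K has derivative zero along 𝔭 ⊂ 𝔨, so the g_t-product of its differential with that of
any function on G ⧸ H is C⁻¹ times the `energy`, the A-product of the two differentials restricted
to 𝔪.

Consequently lifting carries Δ_S to C Δ_t (`IsLaplacian.comp_quotientMapOfLE`), and fibre
integration, the adjoint of lifting, carries Δ_t to C⁻¹ Δ_S (`IsLaplacian.fiberAverage`). On G,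
fibre integration is the average over right translations by K; it passes through the energy because
𝔪 and A are Ad(K)-invariant (`rightAverage_energy`).

Eigenfunctions are only L² and the equation is weak, so the two statements on smooth functions are
applied to test functions: the equation for ψ is tested by lifting, the one for ψ ∘ q by averaging
along the fibres (`isLaplaceEigenfunction_comp_quotientMapOfLE_iff`). The eigenvalues differ by the
factor C. Measurability and null sets also descend from G to G ⧸ K by averaging over K, so a
function constant along the fibres really is the lift of an L² function. -/

noncomputable section

set_option linter.unusedSectionVars false

/-! ### Gram determinants. -/

section Gram

variable {V : Type*} [AddCommGroup V] [Module ℝ V]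

theorem det_gram_pos {n : ℕ} (B : V →ₗ[ℝ] V →ₗ[ℝ] ℝ) (hsymm : ∀ v w, B v w = B w v)
    (hpos : ∀ v, v ≠ 0 → 0 < B v v) {v : Fin n → V} (hv : LinearIndependent ℝ v) :
    0 < (Matrix.of fun i j => B (v i) (v j)).det := by
  refine Matrix.PosDef.det_pos (Matrix.PosDef.of_dotProduct_mulVec_pos ?_ ?_)
  · ext i j
    simp [hsymm]
  · intro x hx
    have h : star x ⬝ᵥ (Matrix.of fun i j => B (v i) (v j)).mulVec x =
        B (∑ i, x i • v i) (∑ i, x i • v i) := by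
      simp [dotProduct, Matrix.mulVec, map_sum, LinearMap.sum_apply]
      refine Finset.sum_congr rfl fun a _ => ?_
      congr 1
      exact Finset.sum_congr rfl fun b _ => by rw [hsymm, mul_comm]
    rw [h]
    refine hpos _ fun h0 => hx ?_
    exact funext (Fintype.linearIndependent_iff.1 hv x h0)

/-- With T a Jacobian matrix, the determinant of this congruence is the source of the factor (det
T)² between volume densities. -/
theorem gram_sum_smul {n : ℕ} (B : V →ₗ[ℝ] V →ₗ[ℝ] ℝ) (T : Matrix (Fin n) (Fin n) ℝ)
    (v : Fin n → V) :
    (Matrix.of fun i j => B (∑ k, T k i • v k) (∑ k, T k j • v k)) =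
      T.transpose * (Matrix.of fun i j => B (v i) (v j)) * T := by
  ext i j
  simp only [Matrix.mul_apply, Matrix.transpose_apply, Matrix.of_apply, map_sum, map_smul,
    LinearMap.sum_apply, LinearMap.smul_apply, smul_eq_mul, Finset.sum_mul, Finset.mul_sum]
  refine Finset.sum_congr rfl fun a _ => Finset.sum_congr rfl fun b _ => ?_
  ring

end Gram

/-! ### Continuity of a Riemannian metric along continuous fields. -/

section Bundle

variable {EB : Type*} [NormedAddCommGroup EB] [NormedSpace ℝ EB]
  {HB : Type*} [TopologicalSpace HB] {IB : ModelWithCorners ℝ EB HB} {n : ℕ∞ω}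
  {B : Type*} [TopologicalSpace B] [ChartedSpace HB B]
  {F : Type*} [NormedAddCommGroup F] [NormedSpace ℝ F]
  {E : B → Type*} [TopologicalSpace (Bundle.TotalSpace F E)]
  [∀ b, TopologicalSpace (E b)] [∀ b, AddCommGroup (E b)] [∀ b, Module ℝ (E b)]
  [∀ b, IsTopologicalAddGroup (E b)] [∀ b, ContinuousConstSMul ℝ (E b)]
  [FiberBundle F E] [VectorBundle ℝ F E]

theorem Bundle.ContMDiffRiemannianMetric.continuousOn_inner
    (g : Bundle.ContMDiffRiemannianMetric IB n F E) {X : Type*} [TopologicalSpace X] {s : Set X}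
    {b : X → B} {v w : ∀ x, E (b x)}
    (hv : ContinuousOn (fun x => (⟨b x, v x⟩ : Bundle.TotalSpace F E)) s)
    (hw : ContinuousOn (fun x => (⟨b x, w x⟩ : Bundle.TotalSpace F E)) s) :
    ContinuousOn (fun x => g.inner (b x) (v x) (w x)) s := by
  let _ : Bundle.RiemannianBundle E := ⟨g.toRiemannianMetric⟩
  have : IsContinuousRiemannianBundle F E :=
    ⟨g.inner, g.contMDiff.continuous, fun _ _ _ => rfl⟩
  exact ContinuousOn.inner_bundle hv hw

end Bundle

/-! ### Riemannian volume: finiteness, positivity, invariance under isometries. -/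

section Volume

variable {n : ℕ} {N : Type*} [TopologicalSpace N]
  [ChartedSpace (EuclideanSpace ℝ (Fin n)) N] [IsManifold (𝓡 n) ∞ N]

/-- The inner product of a metric at `x`, as a bilinear form. -/
def metricForm (g : SmoothMetric n N) (x : N) :
    TangentSpace (𝓡 n) x →ₗ[ℝ] TangentSpace (𝓡 n) x →ₗ[ℝ] ℝ :=
  (ContinuousLinearMap.coeLM ℝ).comp (g.inner x).toLinearMap

/-- The fields fed to the metric are the tangent map of the inverse chart applied to constant
sections, hence continuous. -/
theorem continuousOn_metric_mfderiv_chart_symm (g : SmoothMetric n N) (x : N)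
    (v w : EuclideanSpace ℝ (Fin n)) :
    ContinuousOn (fun y => g.inner ((chartAt (EuclideanSpace ℝ (Fin n)) x).symm y)
      (mfderiv (𝓡 n) (𝓡 n) (chartAt (EuclideanSpace ℝ (Fin n)) x).symm y v)
      (mfderiv (𝓡 n) (𝓡 n) (chartAt (EuclideanSpace ℝ (Fin n)) x).symm y w))
      (chartAt (EuclideanSpace ℝ (Fin n)) x).target := by
  set c := chartAt (EuclideanSpace ℝ (Fin n)) x with hc
  have hs : ContMDiffOn (𝓡 n) (𝓡 n) ∞ c.symm c.target := contMDiffOn_chart_symm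
  have hT : ∀ v : EuclideanSpace ℝ (Fin n), ContinuousOn (fun y =>
      (⟨c.symm y, mfderiv (𝓡 n) (𝓡 n) c.symm y v⟩ : TangentBundle (𝓡 n) N)) c.target := by
    intro v
    have h1 := hs.continuousOn_tangentMapWithin (by simp) c.open_target.uniqueMDiffOn
    have h2 : ContinuousOn (fun y : EuclideanSpace ℝ (Fin n) =>
        (⟨y, v⟩ : TangentBundle (𝓡 n) (EuclideanSpace ℝ (Fin n)))) c.target := by
      have := (tangentBundleModelSpaceHomeomorph (𝓡 n)).symm.continuous.comp
        (Continuous.prodMk continuous_id (continuous_const (y := v)))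
      exact this.continuousOn
    refine (h1.comp h2 (fun y hy => hy)).congr ?_
    intro y hy
    simp only [Function.comp, tangentMapWithin]
    rw [mfderivWithin_of_isOpen c.open_target hy]
  exact g.continuousOn_inner (hT v) (hT w)

theorem continuousOn_volumeDensity (g : SmoothMetric n N) (x : N) :
    ContinuousOn (volumeDensity g x) (chartAt (EuclideanSpace ℝ (Fin n)) x).target := by
  unfold volumeDensity
  refine Real.continuous_sqrt.comp_continuousOn ?_
  refine (continuous_id.matrix_det).comp_continuousOn (f := fun y => Matrix.of fun i j =>
    g.inner ((chartAt (EuclideanSpace ℝ (Fin n)) x).symm y)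
      (mfderiv (𝓡 n) (𝓡 n) (chartAt (EuclideanSpace ℝ (Fin n)) x).symm y
        (EuclideanSpace.single i (1 : ℝ)))
      (mfderiv (𝓡 n) (𝓡 n) (chartAt (EuclideanSpace ℝ (Fin n)) x).symm y
        (EuclideanSpace.single j (1 : ℝ)))) ?_
  refine continuousOn_pi.2 fun i => continuousOn_pi.2 fun j => ?_
  exact continuousOn_metric_mfderiv_chart_symm g x _ _

/-- The derivative of the inverse chart is injective, so the coordinate vectors are independent and
their Gram determinant is positive. -/
theorem volumeDensity_pos (g : SmoothMetric n N) (x : N) {y : EuclideanSpace ℝ (Fin n)}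
    (hy : y ∈ (chartAt (EuclideanSpace ℝ (Fin n)) x).target) : 0 < volumeDensity g x y := by
  unfold volumeDensity
  refine Real.sqrt_pos.2 ?_
  have hker := ((mdifferentiable_chart (I := 𝓡 n) x).symm).ker_mfderiv_eq_bot (x := y) hy
  have hli : LinearIndependent ℝ (fun i : Fin n =>
      (mfderiv (𝓡 n) (𝓡 n) (chartAt (EuclideanSpace ℝ (Fin n)) x).symm y
        (EuclideanSpace.single i (1 : ℝ)))) := by
    have hb := (EuclideanSpace.basisFun (Fin n) ℝ).toBasis.linearIndependent
    have := hb.map' (mfderiv (𝓡 n) (𝓡 n)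
      (chartAt (EuclideanSpace ℝ (Fin n)) x).symm y).toLinearMap hker
    have h2 : (fun i : Fin n => (mfderiv (𝓡 n) (𝓡 n)
        (chartAt (EuclideanSpace ℝ (Fin n)) x).symm y (EuclideanSpace.single i (1 : ℝ)))) =
        (mfderiv (𝓡 n) (𝓡 n) (chartAt (EuclideanSpace ℝ (Fin n)) x).symm y).toLinearMap ∘
          (EuclideanSpace.basisFun (Fin n) ℝ).toBasis := by
      funext i
      simp [Function.comp]
    rw [h2]
    exact this
  exact det_gram_pos (metricForm g ((chartAt (EuclideanSpace ℝ (Fin n)) x).symm y))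
    (g.symm _) (g.pos _) hli

/-- Since F preserves inner products, the Gram matrices in the two charts are congruent through the
Jacobian of the coordinate expression of F; the square root of the determinant gives the factor. -/
theorem volumeDensity_eq_abs_det_mul {N' : Type*} [TopologicalSpace N']
    [ChartedSpace (EuclideanSpace ℝ (Fin n)) N'] [IsManifold (𝓡 n) ∞ N']
    (g : SmoothMetric n N) (g' : SmoothMetric n N') {F : N → N'}
    (hF : ContMDiff (𝓡 n) (𝓡 n) ∞ F)
    (hiso : ∀ (x : N) (v w : TangentSpace (𝓡 n) x), g'.inner (F x)
      (mfderiv (𝓡 n) (𝓡 n) F x v) (mfderiv (𝓡 n) (𝓡 n) F x w) = g.inner x v w)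
    (x : N) (x' : N') {z : EuclideanSpace ℝ (Fin n)}
    (hz : z ∈ (chartAt (EuclideanSpace ℝ (Fin n)) x).target)
    (hz' : F ((chartAt (EuclideanSpace ℝ (Fin n)) x).symm z) ∈
      (chartAt (EuclideanSpace ℝ (Fin n)) x').source) :
    DifferentiableAt ℝ (chartAt (EuclideanSpace ℝ (Fin n)) x' ∘ F ∘
        (chartAt (EuclideanSpace ℝ (Fin n)) x).symm) z ∧
    volumeDensity g x z =
      |(fderiv ℝ (chartAt (EuclideanSpace ℝ (Fin n)) x' ∘ F ∘
        (chartAt (EuclideanSpace ℝ (Fin n)) x).symm) z).det| *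
      volumeDensity g' x' (chartAt (EuclideanSpace ℝ (Fin n)) x' (F
        ((chartAt (EuclideanSpace ℝ (Fin n)) x).symm z))) := by
  set c := chartAt (EuclideanSpace ℝ (Fin n)) x with hc
  set c' := chartAt (EuclideanSpace ℝ (Fin n)) x' with hc'
  set τ := c' ∘ F ∘ c.symm with hτ
  have hcd : MDifferentiableAt (𝓡 n) (𝓡 n) c.symm z :=
    (mdifferentiable_chart (I := 𝓡 n) x).symm.mdifferentiableAt hz
  have hFd : MDifferentiableAt (𝓡 n) (𝓡 n) F (c.symm z) :=
    hF.mdifferentiableAt (by simp)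
  have hc'd : MDifferentiableAt (𝓡 n) (𝓡 n) c' (F (c.symm z)) :=
    (mdifferentiable_chart (I := 𝓡 n) x').mdifferentiableAt hz'
  have hτd : MDifferentiableAt (𝓡 n) (𝓡 n) τ z := hc'd.comp z (hFd.comp z hcd)
  have hτd' : DifferentiableAt ℝ τ z := mdifferentiableAt_iff_differentiableAt.1 hτd
  refine ⟨hτd', ?_⟩
  have hc'sd : MDifferentiableAt (𝓡 n) (𝓡 n) c'.symm (τ z) :=
    (mdifferentiable_chart (I := 𝓡 n) x').symm.mdifferentiableAt (c'.map_source hz')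
  have hpt : c'.symm (τ z) = F (c.symm z) := c'.left_inv hz'
  -- The two factorizations agree only where F lands in the second chart, which by continuity is a
  -- neighbourhood of `z`; that is enough to equate derivatives.
  have hev : F ∘ c.symm =ᶠ[𝓝 z] c'.symm ∘ τ := by
    have hcont : ContinuousAt (F ∘ c.symm) z := (hFd.comp z hcd).continuousAt
    filter_upwards [hcont.preimage_mem_nhds (c'.open_source.mem_nhds hz')] with y hy
    exact (c'.left_inv hy).symm
  have hder : ∀ v : EuclideanSpace ℝ (Fin n),
      (mfderiv (𝓡 n) (𝓡 n) F (c.symm z) (mfderiv (𝓡 n) (𝓡 n) c.symm z v) :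
        EuclideanSpace ℝ (Fin n)) =
      mfderiv (𝓡 n) (𝓡 n) c'.symm (τ z) (fderiv ℝ τ z v) := by
    intro v
    have h1 := mfderiv_comp z hFd hcd
    have h2 := mfderiv_comp z hc'sd hτd
    have h3 := hev.mfderiv_eq (I := 𝓡 n) (I' := 𝓡 n)
    rw [mfderiv_eq_fderiv] at h2
    have h4 := h1.symm.trans (h3.trans h2)
    exact DFunLike.congr_fun h4 v
  set T : Matrix (Fin n) (Fin n) ℝ := Matrix.of fun k i =>
    (fderiv ℝ τ z (EuclideanSpace.single i (1 : ℝ))) k with hT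
  have hTdet : T.det = (fderiv ℝ τ z).det := by
    rw [ContinuousLinearMap.det, ← LinearMap.det_toMatrix
      (EuclideanSpace.basisFun (Fin n) ℝ).toBasis]
    congr 1
  have hsum : ∀ i, fderiv ℝ τ z (EuclideanSpace.single i (1 : ℝ)) =
      ∑ k, T k i • EuclideanSpace.single k (1 : ℝ) := by
    intro i
    have := (EuclideanSpace.basisFun (Fin n) ℝ).sum_repr
      (fderiv ℝ τ z (EuclideanSpace.single i (1 : ℝ)))
    simpa [T] using this.symm
  have hgram : (Matrix.of fun i j => g.inner (c.symm z)
        (mfderiv (𝓡 n) (𝓡 n) c.symm z (EuclideanSpace.single i (1 : ℝ)))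
        (mfderiv (𝓡 n) (𝓡 n) c.symm z (EuclideanSpace.single j (1 : ℝ)))) =
      T.transpose * (Matrix.of fun i j => g'.inner (c'.symm (τ z))
        (mfderiv (𝓡 n) (𝓡 n) c'.symm (τ z) (EuclideanSpace.single i (1 : ℝ)))
        (mfderiv (𝓡 n) (𝓡 n) c'.symm (τ z) (EuclideanSpace.single j (1 : ℝ)))) * T := by
    ext i j
    have e1 := hiso (c.symm z) (mfderiv (𝓡 n) (𝓡 n) c.symm z (EuclideanSpace.single i (1 : ℝ)))
      (mfderiv (𝓡 n) (𝓡 n) c.symm z (EuclideanSpace.single j (1 : ℝ)))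
    have e2 : g'.inner (F (c.symm z))
        (mfderiv (𝓡 n) (𝓡 n) F (c.symm z) (mfderiv (𝓡 n) (𝓡 n) c.symm z
          (EuclideanSpace.single i (1 : ℝ))))
        (mfderiv (𝓡 n) (𝓡 n) F (c.symm z) (mfderiv (𝓡 n) (𝓡 n) c.symm z
          (EuclideanSpace.single j (1 : ℝ)))) =
        g'.inner (c'.symm (τ z))
          (mfderiv (𝓡 n) (𝓡 n) c'.symm (τ z) (fderiv ℝ τ z (EuclideanSpace.single i (1 : ℝ))))
          (mfderiv (𝓡 n) (𝓡 n) c'.symm (τ z) (fderiv ℝ τ z (EuclideanSpace.single j (1 : ℝ)))) := by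
      rw [← hder, ← hder, hpt]
    have e3 := congr_fun (congr_fun (gram_sum_smul (metricForm g' (c'.symm (τ z))) T
      fun k => mfderiv (𝓡 n) (𝓡 n) c'.symm (τ z) (EuclideanSpace.single k (1 : ℝ))) i) j
    refine (e1.symm.trans e2).trans (Eq.trans ?_ e3)
    let D : EuclideanSpace ℝ (Fin n) →L[ℝ] TangentSpace (𝓡 n) (c'.symm (τ z)) :=
      mfderiv (𝓡 n) (𝓡 n) c'.symm (τ z)
    have hD : ∀ i, D (fderiv ℝ τ z (EuclideanSpace.single i (1 : ℝ))) =
        ∑ k, T k i • D (EuclideanSpace.single k (1 : ℝ)) := by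
      intro i
      rw [hsum, map_sum]
      simp only [map_smul]
    change metricForm g' (c'.symm (τ z)) (D (fderiv ℝ τ z (EuclideanSpace.single i (1 : ℝ))))
      (D (fderiv ℝ τ z (EuclideanSpace.single j (1 : ℝ)))) = _
    rw [hD, hD]
    rfl
  change Real.sqrt (Matrix.det (Matrix.of fun i j => g.inner (c.symm z)
        (mfderiv (𝓡 n) (𝓡 n) c.symm z (EuclideanSpace.single i (1 : ℝ)))
        (mfderiv (𝓡 n) (𝓡 n) c.symm z (EuclideanSpace.single j (1 : ℝ))))) =
     _ * Real.sqrt (Matrix.det (Matrix.of fun i j => g'.inner (c'.symm (τ z))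
        (mfderiv (𝓡 n) (𝓡 n) c'.symm (τ z) (EuclideanSpace.single i (1 : ℝ)))
        (mfderiv (𝓡 n) (𝓡 n) c'.symm (τ z) (EuclideanSpace.single j (1 : ℝ)))))
  rw [hgram, Matrix.det_mul, Matrix.det_mul, Matrix.det_transpose, hTdet, mul_right_comm, ← sq,
    Real.sqrt_mul (sq_nonneg _), Real.sqrt_sq_eq_abs]

theorem aemeasurable_chart_symm [MeasurableSpace N] [BorelSpace N] (x : N) :
    AEMeasurable (chartAt (EuclideanSpace ℝ (Fin n)) x).symm
      (volume.restrict (chartAt (EuclideanSpace ℝ (Fin n)) x).target) :=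
  (chartAt (EuclideanSpace ℝ (Fin n)) x).continuousOn_symm.aemeasurable
    (chartAt (EuclideanSpace ℝ (Fin n)) x).open_target.measurableSet

theorem measurableSet_chart_symm_preimage [MeasurableSpace N] [BorelSpace N] (x : N) {A : Set N}
    (hA : MeasurableSet A) : MeasurableSet ((chartAt (EuclideanSpace ℝ (Fin n)) x).target ∩
      (chartAt (EuclideanSpace ℝ (Fin n)) x).symm ⁻¹' A) := by
  set c := chartAt (EuclideanSpace ℝ (Fin n)) x
  have hm : Measurable (c.target.domRestrict c.symm) :=
    (continuousOn_iff_continuous_domRestrict.1 c.continuousOn_symm).measurable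
  have := (MeasurableEmbedding.subtype_coe c.open_target.measurableSet).measurableSet_image.2
    (hm hA)
  convert this using 1
  ext y
  simp [and_comm]

theorem chartVolume_apply [MeasurableSpace N] [BorelSpace N] (g : SmoothMetric n N) (x : N)
    {A : Set N} (hA : MeasurableSet A) :
    chartVolume g x A = ∫⁻ y in (chartAt (EuclideanSpace ℝ (Fin n)) x).target ∩
      (chartAt (EuclideanSpace ℝ (Fin n)) x).symm ⁻¹' A, ENNReal.ofReal (volumeDensity g x y) := by
  set c := chartAt (EuclideanSpace ℝ (Fin n)) x with hc
  have hae : AEMeasurable c.symm ((volume.restrict c.target).withDensity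
      (fun y => ENNReal.ofReal (volumeDensity g x y))) :=
    (aemeasurable_chart_symm x).mono_ac (withDensity_absolutelyContinuous _ _)
  rw [chartVolume, Measure.map_apply_of_aemeasurable hae hA, withDensity_apply',
    Measure.restrict_restrict' c.open_target.measurableSet, inter_comm]

/-- Change of variables on the part of one chart that F sends into the other. Injectivity of F
suffices, because the image only has to lie inside the second domain: hence an inequality. -/
theorem map_chartVolume_restrict_le [MeasurableSpace N] [BorelSpace N]
    {N' : Type*} [TopologicalSpace N']
    [ChartedSpace (EuclideanSpace ℝ (Fin n)) N'] [IsManifold (𝓡 n) ∞ N']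
    [MeasurableSpace N'] [BorelSpace N']
    (g : SmoothMetric n N) (g' : SmoothMetric n N') {F : N → N'}
    (hF : ContMDiff (𝓡 n) (𝓡 n) ∞ F) (hinj : Function.Injective F)
    (hiso : ∀ (x : N) (v w : TangentSpace (𝓡 n) x), g'.inner (F x)
      (mfderiv (𝓡 n) (𝓡 n) F x v) (mfderiv (𝓡 n) (𝓡 n) F x w) = g.inner x v w)
    (x : N) (x' : N') :
    ((chartVolume g x).map F).restrict (chartAt (EuclideanSpace ℝ (Fin n)) x').source ≤
      chartVolume g' x' := by
  set c := chartAt (EuclideanSpace ℝ (Fin n)) x with hc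
  set c' := chartAt (EuclideanSpace ℝ (Fin n)) x' with hc'
  refine Measure.le_iff.2 fun A hA => ?_
  have hAc : MeasurableSet (A ∩ c'.source) := hA.inter c'.open_source.measurableSet
  have hFm : Measurable F := hF.continuous.measurable
  rw [Measure.restrict_apply hA, Measure.map_apply hFm hAc, chartVolume_apply g x (hFm hAc),
    chartVolume_apply g' x' hA]
  set D := c.target ∩ c.symm ⁻¹' (F ⁻¹' (A ∩ c'.source)) with hD
  have hDm : MeasurableSet D := measurableSet_chart_symm_preimage x (hFm hAc)
  have hkey := fun z (hz : z ∈ D) =>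
    volumeDensity_eq_abs_det_mul g g' hF hiso x x' hz.1 hz.2.2
  have hinjD : InjOn (c' ∘ F ∘ c.symm) D := by
    intro y hy z hz hyz
    have h1 := c'.injOn hy.2.2 hz.2.2 hyz
    exact c.symm.injOn hy.1 hz.1 (hinj h1)
  calc ∫⁻ y in D, ENNReal.ofReal (volumeDensity g x y)
      = ∫⁻ y in D, ENNReal.ofReal |(fderiv ℝ (c' ∘ F ∘ c.symm) y).det| *
          ENNReal.ofReal (volumeDensity g' x' ((c' ∘ F ∘ c.symm) y)) := by
        refine setLIntegral_congr_fun hDm fun z hz => ?_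
        beta_reduce
        rw [(hkey z hz).2, ENNReal.ofReal_mul (abs_nonneg _)]
        rfl
    _ = ∫⁻ y in (c' ∘ F ∘ c.symm) '' D, ENNReal.ofReal (volumeDensity g' x' y) :=
        (lintegral_image_eq_lintegral_abs_det_fderiv_mul volume hDm
          (fun z hz => (hkey z hz).1.hasFDerivAt.hasFDerivWithinAt) hinjD
          (fun y => ENNReal.ofReal (volumeDensity g' x' y))).symm
    _ ≤ _ := by
        refine lintegral_mono_set ?_
        rintro _ ⟨z, hz, rfl⟩
        refine ⟨c'.map_source hz.2.2, ?_⟩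
        have : c'.symm (c' (F (c.symm z))) = F (c.symm z) := c'.left_inv hz.2.2
        rw [mem_preimage, Function.comp, Function.comp, this]
        exact hz.2.1

theorem Measure.restrict_biUnion_finset_le {X : Type*} [MeasurableSpace X] {ι : Type*}
    {μ ν : Measure X} {s : ι → Set X} (hs : ∀ i, MeasurableSet (s i))
    (h : ∀ i, μ.restrict (s i) ≤ ν) (t : Finset ι) : μ.restrict (⋃ i ∈ t, s i) ≤ ν := by
  classical
  induction t using Finset.induction_on with
  | empty => simpa using Measure.zero_le ν
  | insert a t _ ih =>
    rw [Finset.set_biUnion_insert]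
    refine Measure.le_iff.2 fun A hA => ?_
    -- Cut A along `s a`: the new bound handles the part inside, the induction hypothesis the part
    -- outside, and ν is additive over the two.
    set U := ⋃ i ∈ t, s i
    have h1 := h a (A ∩ s a)
    have h2 := ih (A \ s a)
    rw [Measure.restrict_apply (hA.inter (hs a))] at h1
    rw [Measure.restrict_apply (hA.diff (hs a))] at h2
    rw [Measure.restrict_apply hA]
    calc μ (A ∩ (s a ∪ U)) ≤ μ (A ∩ s a ∩ s a ∪ (A \ s a) ∩ U) := by
          refine measure_mono ?_
          rintro y ⟨hyA, hy⟩
          by_cases hya : y ∈ s a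
          · exact Or.inl ⟨⟨hyA, hya⟩, hya⟩
          · exact Or.inr ⟨⟨hyA, hya⟩, hy.resolve_left hya⟩
      _ ≤ μ (A ∩ s a ∩ s a) + μ ((A \ s a) ∩ U) := measure_union_le _ _
      _ ≤ ν (A ∩ s a) + ν (A \ s a) := add_le_add h1 h2
      _ = ν A := measure_inter_add_sdiff A (hs a)

/-- The local comparisons hold on chart domains; by compactness finitely many of these cover the
target. -/
theorem map_chartVolume_le [MeasurableSpace N] [BorelSpace N]
    {N' : Type*} [TopologicalSpace N'] [CompactSpace N']
    [ChartedSpace (EuclideanSpace ℝ (Fin n)) N'] [IsManifold (𝓡 n) ∞ N']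
    [MeasurableSpace N'] [BorelSpace N']
    (g : SmoothMetric n N) (g' : SmoothMetric n N') {F : N → N'}
    (hF : ContMDiff (𝓡 n) (𝓡 n) ∞ F) (hinj : Function.Injective F)
    (hiso : ∀ (x : N) (v w : TangentSpace (𝓡 n) x), g'.inner (F x)
      (mfderiv (𝓡 n) (𝓡 n) F x v) (mfderiv (𝓡 n) (𝓡 n) F x w) = g.inner x v w) (x : N) :
    (chartVolume g x).map F ≤ riemannianVolume g' := by
  obtain ⟨t, ht⟩ := CompactSpace.elim_nhds_subcover
    (fun x' : N' => (chartAt (EuclideanSpace ℝ (Fin n)) x').source)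
    (fun x' => chart_source_mem_nhds _ x')
  have h := Measure.restrict_biUnion_finset_le (μ := (chartVolume g x).map F)
    (ν := riemannianVolume g') (s := fun x' => (chartAt (EuclideanSpace ℝ (Fin n)) x').source)
    (fun x' => (chartAt (EuclideanSpace ℝ (Fin n)) x').open_source.measurableSet)
    (fun x' => (map_chartVolume_restrict_le g g' hF hinj hiso x x').trans
      (le_iSup (fun x => chartVolume g' x) x')) t
  rwa [ht, top_eq_univ, Measure.restrict_univ] at h

/-- The Riemannian volume of a compact manifold is finite. -/
theorem isFiniteMeasure_riemannianVolume [CompactSpace N] [MeasurableSpace N] [BorelSpace N]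
    (g : SmoothMetric n N) : IsFiniteMeasure (riemannianVolume g) := by
  have hloc : ∀ x : N, ∃ U ∈ 𝓝 x, riemannianVolume g U < ⊤ := by
    intro x
    set c := chartAt (EuclideanSpace ℝ (Fin n)) x with hc
    obtain ⟨r, hr, hrc⟩ := Metric.nhds_basis_closedBall.mem_iff.1
      (c.open_target.mem_nhds (c.map_source (mem_chart_source _ x)))
    obtain ⟨C, hC⟩ := (isCompact_closedBall (c x) r).bddAbove_image
      ((continuousOn_volumeDensity g x).mono hrc)
    set U := c.source ∩ c ⁻¹' (Metric.ball (c x) r) with hU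
    have hUo : IsOpen U := c.isOpen_inter_preimage Metric.isOpen_ball
    have hxU : x ∈ U := ⟨mem_chart_source _ x, Metric.mem_ball_self hr⟩
    refine ⟨U, hUo.mem_nhds hxU, ?_⟩
    -- A supremum of measures is bounded by exhibiting one upper bound. On U the comparison for the
    -- identity map bounds every chart volume by the one at `x`; off U nothing is needed, so the
    -- largest measure serves.
    have hle : riemannianVolume g ≤ chartVolume g x + (⊤ : Measure N).restrict Uᶜ := by
      refine iSup_le fun y => ?_
      have hid := map_chartVolume_restrict_le g g (F := id) contMDiff_id Function.injective_id
        (fun x v w => by rw [mfderiv_id]; rfl) y x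
      rw [Measure.map_id] at hid
      calc chartVolume g y = (chartVolume g y).restrict U + (chartVolume g y).restrict Uᶜ :=
            (Measure.restrict_add_restrict_compl hUo.measurableSet).symm
        _ ≤ _ := add_le_add ((Measure.restrict_mono inter_subset_left le_rfl).trans hid)
            (Measure.restrict_mono subset_rfl le_top)
    refine (hle U).trans_lt ?_
    rw [Measure.add_apply, Measure.restrict_apply hUo.measurableSet, inter_compl_self,
      measure_empty, add_zero, chartVolume_apply g x hUo.measurableSet]
    have hsub : c.target ∩ c.symm ⁻¹' U ⊆ Metric.closedBall (c x) r := by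
      intro y hy
      have := hy.2.2
      rw [mem_preimage, c.right_inv hy.1] at this
      exact Metric.ball_subset_closedBall this
    calc ∫⁻ y in c.target ∩ c.symm ⁻¹' U, ENNReal.ofReal (volumeDensity g x y)
        ≤ ∫⁻ y in Metric.closedBall (c x) r, ENNReal.ofReal (volumeDensity g x y) :=
          lintegral_mono_set hsub
      _ ≤ ∫⁻ _ in Metric.closedBall (c x) r, ENNReal.ofReal C :=
          setLIntegral_mono measurable_const fun y hy =>
            ENNReal.ofReal_le_ofReal (hC (mem_image_of_mem _ hy))
      _ < ⊤ := by
          rw [setLIntegral_const]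
          exact ENNReal.mul_lt_top ENNReal.ofReal_lt_top measure_closedBall_lt_top
  choose U hU hU' using hloc
  obtain ⟨t, ht⟩ := CompactSpace.elim_nhds_subcover U hU
  refine ⟨?_⟩
  rw [← top_eq_univ, ← ht]
  exact (measure_biUnion_finset_le t U).trans_lt (ENNReal.sum_lt_top.2 fun x _ => hU' x)

theorem riemannianVolume_ne_zero [Nonempty N] [MeasurableSpace N] [BorelSpace N]
    (g : SmoothMetric n N) : riemannianVolume g ≠ 0 := by
  obtain ⟨x⟩ := ‹Nonempty N›
  set c := chartAt (EuclideanSpace ℝ (Fin n)) x with hc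
  intro h0
  have h1 : chartVolume g x univ = 0 := by
    have : chartVolume g x ≤ 0 := h0 ▸ le_iSup (fun x => chartVolume g x) x
    exact le_antisymm (this univ) zero_le
  rw [chartVolume_apply g x MeasurableSet.univ, preimage_univ, inter_univ] at h1
  have hm : AEMeasurable (fun y => ENNReal.ofReal (volumeDensity g x y))
      (volume.restrict c.target) :=
    ((continuousOn_volumeDensity g x).aemeasurable c.open_target.measurableSet).ennreal_ofReal
  rw [lintegral_eq_zero_iff' hm] at h1
  have h2 := (ae_restrict_iff' c.open_target.measurableSet).1 h1
  have h3 : volume c.target = 0 := by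
    refine measure_mono_null ?_ (ae_iff.1 h2)
    intro y hy h
    have := h hy
    simp only [Pi.zero_apply, ENNReal.ofReal_eq_zero] at this
    exact absurd (volumeDensity_pos g x hy) (not_lt.2 this)
  exact (c.open_target.measure_pos volume ⟨c x, c.map_source (mem_chart_source _ x)⟩).ne' h3

/-- The Riemannian volume is invariant under isometries. -/
theorem map_riemannianVolume [CompactSpace N] [MeasurableSpace N] [BorelSpace N]
    (g : SmoothMetric n N) {F F' : N → N} (hF : ContMDiff (𝓡 n) (𝓡 n) ∞ F)
    (hF' : ContMDiff (𝓡 n) (𝓡 n) ∞ F') (hl : Function.LeftInverse F' F)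
    (hr : Function.RightInverse F' F)
    (hiso : ∀ (x : N) (v w : TangentSpace (𝓡 n) x), g.inner (F x)
      (mfderiv (𝓡 n) (𝓡 n) F x v) (mfderiv (𝓡 n) (𝓡 n) F x w) = g.inner x v w)
    (hiso' : ∀ (x : N) (v w : TangentSpace (𝓡 n) x), g.inner (F' x)
      (mfderiv (𝓡 n) (𝓡 n) F' x v) (mfderiv (𝓡 n) (𝓡 n) F' x w) = g.inner x v w) :
    (riemannianVolume g).map F = riemannianVolume g := by
  have hFm : Measurable F := hF.continuous.measurable
  have hFm' : Measurable F' := hF'.continuous.measurable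
  -- The one-sided bound for the inverse, pushed forward by F, gives this inequality; the same with
  -- the roles exchanged gives the reverse one.
  have h1 : riemannianVolume g ≤ (riemannianVolume g).map F := by
    refine iSup_le fun x => ?_
    have h := map_chartVolume_le g g hF' hr.injective hiso' x
    have h2 := Measure.map_mono (f := F) h hFm
    rwa [Measure.map_map hFm hFm', hr.comp_eq_id, Measure.map_id] at h2
  have h1' : riemannianVolume g ≤ (riemannianVolume g).map F' := by
    refine iSup_le fun x => ?_
    have h := map_chartVolume_le g g hF hl.injective hiso x
    have h2 := Measure.map_mono (f := F') h hFm'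
    rwa [Measure.map_map hFm' hFm, hl.comp_eq_id, Measure.map_id] at h2
  refine le_antisymm ?_ h1
  have h2 := Measure.map_mono (f := F) h1' hFm
  rwa [Measure.map_map hFm hFm', hr.comp_eq_id, Measure.map_id] at h2

end Volume

/-! ### Local sections of submersions and descent of smoothness. -/

section Submersion

variable {k d : ℕ} {M : Type*} [TopologicalSpace M]
  [ChartedSpace (EuclideanSpace ℝ (Fin k)) M] [IsManifold (𝓡 k) ∞ M]
  {N : Type*} [TopologicalSpace N]
  [ChartedSpace (EuclideanSpace ℝ (Fin d)) N] [IsManifold (𝓡 d) ∞ N]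

/-- A smooth map with surjective differential at `a` has a smooth local section through `a`. -/
theorem exists_local_section {f : M → N} (hf : ContMDiff (𝓡 k) (𝓡 d) ∞ f) (a : M)
    (ha : Function.Surjective (mfderiv (𝓡 k) (𝓡 d) f a)) :
    ∃ σ : N → M, ContMDiffAt (𝓡 d) (𝓡 k) ∞ σ (f a) ∧ σ (f a) = a ∧
      ∀ᶠ y in 𝓝 (f a), f (σ y) = y := by
  set c := chartAt (EuclideanSpace ℝ (Fin k)) a with hc
  set c' := chartAt (EuclideanSpace ℝ (Fin d)) (f a) with hc'
  have hac : a ∈ c.source := mem_chart_source _ a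
  have hac' : f a ∈ c'.source := mem_chart_source _ _
  set τ := c' ∘ f ∘ c.symm with hτ
  have hcs : c.symm (c a) = a := c.left_inv hac
  have hcsm : ContMDiffAt (𝓡 k) (𝓡 k) ∞ c.symm (c a) :=
    contMDiffOn_chart_symm.contMDiffAt (c.open_target.mem_nhds (c.map_source hac))
  have hcm' : ContMDiffAt (𝓡 d) (𝓡 d) ∞ c' (f a) :=
    contMDiffOn_chart.contMDiffAt (c'.open_source.mem_nhds hac')
  have hfc : ContMDiffAt (𝓡 k) (𝓡 d) ∞ (f ∘ c.symm) (c a) :=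
    (hf (c.symm (c a))).comp (c a) hcsm
  have hτm : ContMDiffAt (𝓡 k) (𝓡 d) ∞ τ (c a) :=
    ContMDiffAt.comp (c a) (g := c') (f := f ∘ c.symm)
      (by simpa only [Function.comp, hcs] using hcm') hfc
  have hτc : ContDiffAt ℝ ∞ τ (c a) := contMDiffAt_iff_contDiffAt.1 hτm
  have hsurj : Function.Surjective (fderiv ℝ τ (c a)) := by
    have e1 := mfderiv_comp (c a) (I := 𝓡 k) (I' := 𝓡 d) (I'' := 𝓡 d) (g := c')
      (f := f ∘ c.symm)
      ((by simpa only [Function.comp, hcs] using hcm' : ContMDiffAt (𝓡 d) (𝓡 d) ∞ c'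
        ((f ∘ c.symm) (c a))).mdifferentiableAt (by simp)) (hfc.mdifferentiableAt (by simp))
    have e2 := mfderiv_comp (c a) (I := 𝓡 k) (I' := 𝓡 k) (I'' := 𝓡 d) (g := f) (f := c.symm)
      ((hf (c.symm (c a))).mdifferentiableAt (by simp)) (hcsm.mdifferentiableAt (by simp))
    rw [mfderiv_eq_fderiv, e2] at e1
    have s1 := ((mdifferentiable_chart (I := 𝓡 k) a).symm).mfderiv_surjective
      (x := c a) (c.map_source hac)
    have s3 : Function.Surjective (mfderiv (𝓡 d) (𝓡 d) c' ((f ∘ c.symm) (c a))) :=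
      (mdifferentiable_chart (I := 𝓡 d) (f a)).mfderiv_surjective
        (by simpa only [Function.comp, hcs] using hac')
    have s2 : Function.Surjective (mfderiv (𝓡 k) (𝓡 d) f (c.symm (c a))) := by
      rw [hcs]; exact ha
    change Function.Surjective (fderiv ℝ (c' ∘ f ∘ c.symm) (c a))
    rw [e1]
    exact s3.comp (s2.comp s1)
  -- Restricted to the affine slice `c a + R y`, the coordinate expression has derivative the
  -- identity at 0, so the inverse function theorem applies there; its local inverse, put back into
  -- the slice, is the section.
  obtain ⟨R, hR⟩ := (fderiv ℝ τ (c a)).exists_rightInverse_of_surjective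
    (LinearMap.range_eq_top.2 hsurj)
  let h : EuclideanSpace ℝ (Fin d) → EuclideanSpace ℝ (Fin d) := fun y => τ (c a + R y)
  have hh : ContDiffAt ℝ ∞ h 0 := by
    refine ContDiffAt.comp (0 : EuclideanSpace ℝ (Fin d)) (g := τ) (f := fun y => c a + R y) ?_ ?_
    · simpa using hτc
    · fun_prop
  have hh' : HasFDerivAt h
      ((ContinuousLinearEquiv.refl ℝ (EuclideanSpace ℝ (Fin d)) :
        EuclideanSpace ℝ (Fin d) ≃L[ℝ] EuclideanSpace ℝ (Fin d)) :
        EuclideanSpace ℝ (Fin d) →L[ℝ] EuclideanSpace ℝ (Fin d)) 0 := by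
    have h1 : HasFDerivAt τ (fderiv ℝ τ (c a)) (c a + R 0) := by
      simpa using (hτc.differentiableAt (by simp)).hasFDerivAt
    have h2 : HasFDerivAt (fun y => c a + R y) R 0 := R.hasFDerivAt.const_add _
    have h3 := h1.comp 0 h2
    rw [hR] at h3
    exact h3
  have hstrict := hh.hasStrictFDerivAt' hh' (by simp)
  have hh0 : h 0 = c' (f a) := by simp [h, τ, hcs]
  set inv := hh.localInverse hh' (by simp) with hinv
  have hinv0 : inv (c' (f a)) = 0 := by
    rw [← hh0]; exact hh.localInverse_apply_image hh' (by simp)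
  have hinvs : ContDiffAt ℝ ∞ inv (c' (f a)) := by
    rw [← hh0]; exact hh.to_localInverse hh' (by simp)
  have hright : ∀ᶠ y in 𝓝 (c' (f a)), h (inv y) = y := by
    rw [← hh0]; exact hstrict.eventually_right_inverse
  refine ⟨fun y => c.symm (c a + R (inv (c' y))), ?_, ?_, ?_⟩
  · have m1 : ContMDiffAt (𝓡 d) (𝓡 k) ∞ (fun y => c a + R (inv y)) (c' (f a)) := by
      refine contMDiffAt_iff_contDiffAt.2 ?_
      exact contDiffAt_const.add (R.contDiff.contDiffAt.comp _ hinvs)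
    have m2 := m1.comp (f a) hcm'
    refine ContMDiffAt.comp (f a) (g := c.symm) (f := fun y => c a + R (inv (c' y))) ?_ m2
    simpa [hinv0] using hcsm
  · simp [hinv0, hcs]
  · have hcont : ContinuousAt (fun y => c a + R (inv (c' y))) (f a) := by
      have hi : ContinuousAt inv (c' (f a)) := hinvs.continuousAt
      have := hi.comp (f := c') hcm'.continuousAt
      exact continuousAt_const.add (R.continuous.continuousAt.comp this)
    have hcont2 : ContinuousAt (fun y => f (c.symm (c a + R (inv (c' y))))) (f a) := by
      refine ContinuousAt.comp (g := f ∘ c.symm) (f := fun y => c a + R (inv (c' y))) ?_ hcont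
      simpa [hinv0] using hfc.continuousAt
    have ev1 := hcm'.continuousAt.eventually hright
    have ev2 : ∀ᶠ y in 𝓝 (f a), y ∈ c'.source := c'.open_source.mem_nhds hac'
    have ev3 : ∀ᶠ y in 𝓝 (f a), f (c.symm (c a + R (inv (c' y)))) ∈ c'.source := by
      refine hcont2.preimage_mem_nhds (c'.open_source.mem_nhds ?_)
      simpa [hinv0, hcs] using hac'
    filter_upwards [ev1, ev2, ev3] with y h1 h2 h3
    exact c'.injOn h3 h2 h1

/-- Smoothness descends along surjective submersions. -/
theorem ContMDiff.of_comp_submersion {f : M → N} (hf : ContMDiff (𝓡 k) (𝓡 d) ∞ f)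
    (hf' : ∀ a, Function.Surjective (mfderiv (𝓡 k) (𝓡 d) f a)) (hsurj : Function.Surjective f)
    {E' H' : Type*} [NormedAddCommGroup E'] [NormedSpace ℝ E'] [TopologicalSpace H']
    {I' : ModelWithCorners ℝ E' H'} {P : Type*} [TopologicalSpace P] [ChartedSpace H' P]
    {φ : N → P} (hφ : ContMDiff (𝓡 k) I' ∞ (φ ∘ f)) : ContMDiff (𝓡 d) I' ∞ φ := by
  intro y
  obtain ⟨a, rfl⟩ := hsurj y
  obtain ⟨σ, hσ, hσa, hev⟩ := exists_local_section hf a (hf' a)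
  have h1 : ContMDiffAt (𝓡 d) I' ∞ ((φ ∘ f) ∘ σ) (f a) := (hφ _).comp (f a) hσ
  refine h1.congr_of_eventuallyEq ?_
  filter_upwards [hev] with y hy
  simp [hy]

end Submersion

/-! ### The smooth action on a homogeneous space and invariance of orbit metrics. -/

section Homogeneous

variable {k d : ℕ} {G : Type*} [Group G] [TopologicalSpace G]
  [ChartedSpace (EuclideanSpace ℝ (Fin k)) G] [LieGroup (𝓡 k) ∞ G]
  {H : Subgroup G}
  [ChartedSpace (EuclideanSpace ℝ (Fin d)) (G ⧸ H)] [IsManifold (𝓡 d) ∞ (G ⧸ H)]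

theorem IsHomogeneousStructure.contMDiff_of_comp_mk (hGH : IsHomogeneousStructure k d H)
    {E' H' : Type*} [NormedAddCommGroup E'] [NormedSpace ℝ E'] [TopologicalSpace H']
    {I' : ModelWithCorners ℝ E' H'} {P : Type*} [TopologicalSpace P] [ChartedSpace H' P]
    {φ : G ⧸ H → P} (hφ : ContMDiff (𝓡 k) I' ∞ (fun a : G => φ (QuotientGroup.mk a))) :
    ContMDiff (𝓡 d) I' ∞ φ :=
  ContMDiff.of_comp_submersion (f := (QuotientGroup.mk : G → G ⧸ H)) hGH.1 hGH.2
    QuotientGroup.mk_surjective hφ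

theorem IsHomogeneousStructure.contMDiff_smul (hGH : IsHomogeneousStructure k d H) (a : G) :
    ContMDiff (𝓡 d) (𝓡 d) ∞ (fun x : G ⧸ H => a • x) :=
  hGH.contMDiff_of_comp_mk (hGH.1.comp (contMDiff_mul_left (a := a)))

theorem mfderiv_smul_mk (hGH : IsHomogeneousStructure k d H) (a b : G)
    (v : TangentSpace (𝓡 k) b) :
    mfderiv (𝓡 d) (𝓡 d) (fun x : G ⧸ H => a • x) (QuotientGroup.mk b)
      (mfderiv (𝓡 k) (𝓡 d) (QuotientGroup.mk : G → G ⧸ H) b v) =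
    mfderiv (𝓡 k) (𝓡 d) (QuotientGroup.mk : G → G ⧸ H) (a * b)
      (mfderiv (𝓡 k) (𝓡 k) (fun c : G => a * c) b v) := by
  have h1 := mfderiv_comp b (I := 𝓡 k) (I' := 𝓡 d) (I'' := 𝓡 d)
    (g := fun x : G ⧸ H => a • x) (f := (QuotientGroup.mk : G → G ⧸ H))
    ((hGH.contMDiff_smul a).mdifferentiableAt (by simp)) (hGH.1.mdifferentiableAt (by simp))
  have h2 := mfderiv_comp b (I := 𝓡 k) (I' := 𝓡 k) (I'' := 𝓡 d)
    (g := (QuotientGroup.mk : G → G ⧸ H)) (f := fun c : G => a * c)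
    (hGH.1.mdifferentiableAt (by simp))
    ((contMDiff_mul_left (I := 𝓡 k) (n := ∞) (a := a)).mdifferentiableAt (by simp))
  exact DFunLike.congr_fun (h1.symm.trans h2) v

variable {m : ℕ} {M : Type*} [TopologicalSpace M] [ChartedSpace (EuclideanSpace ℝ (Fin m)) M]
  [IsManifold (𝓡 m) ∞ M] [MulAction G M] [ContMDiffSMul (𝓡 k) (𝓡 m) ∞ G M]

theorem contMDiff_orbitMap (x : M) : ContMDiff (𝓡 k) (𝓡 m) ∞ (fun a : G => a • x) :=
  contMDiff_id.smul contMDiff_const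

theorem mfderiv_orbitMap_mul_left (x : M) (a b : G) (v : TangentSpace (𝓡 k) b) :
    mfderiv (𝓡 k) (𝓡 m) (fun c : G => c • x) (a * b)
      (mfderiv (𝓡 k) (𝓡 k) (fun c : G => a * c) b v) =
    mfderiv (𝓡 m) (𝓡 m) (fun y : M => a • y) (b • x)
      (mfderiv (𝓡 k) (𝓡 m) (fun c : G => c • x) b v) := by
  have h1 := mfderiv_comp b (I := 𝓡 k) (I' := 𝓡 k) (I'' := 𝓡 m)
    (g := fun c : G => c • x) (f := fun c : G => a * c)
    ((contMDiff_orbitMap x).mdifferentiableAt (by simp))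
    ((contMDiff_mul_left (I := 𝓡 k) (n := ∞) (a := a)).mdifferentiableAt (by simp))
  have h2 := mfderiv_comp b (I := 𝓡 k) (I' := 𝓡 m) (I'' := 𝓡 m)
    (g := fun y : M => a • y) (f := fun c : G => c • x)
    ((ContMDiffSMul.contMDiff_const_smul (I := 𝓡 k) (I' := 𝓡 m) (n := ∞) a).mdifferentiableAt
      (by simp))
    ((contMDiff_orbitMap x).mdifferentiableAt (by simp))
  have h3 : (fun c : G => c • x) ∘ (fun c : G => a * c) =
      (fun y : M => a • y) ∘ (fun c : G => c • x) := by
    funext c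
    simp [mul_smul]
  rw [h3] at h1
  exact DFunLike.congr_fun (h1.symm.trans h2) v

/-- Tangent vectors of G ⧸ H lift to G, where translation by `a` becomes, through the equivariant
orbit map, the isometry `a` of M. -/
theorem IsOrbitMetric.inner_smul {g : SmoothMetric m M} (hinv : IsInvariantMetric G g) {x : M}
    (hGH : IsHomogeneousStructure k d H) {gN : SmoothMetric d (G ⧸ H)}
    (hgN : IsOrbitMetric k g x gN) (a : G) (y : G ⧸ H) (v w : TangentSpace (𝓡 d) y) :
    gN.inner (a • y) (mfderiv (𝓡 d) (𝓡 d) (fun z : G ⧸ H => a • z) y v)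
      (mfderiv (𝓡 d) (𝓡 d) (fun z : G ⧸ H => a • z) y w) = gN.inner y v w := by
  obtain ⟨b, rfl⟩ := QuotientGroup.mk_surjective y
  obtain ⟨v, rfl⟩ := hGH.2 b v
  obtain ⟨w, rfl⟩ := hGH.2 b w
  rw [mfderiv_smul_mk hGH, mfderiv_smul_mk hGH]
  refine (hgN (a * b) _ _).trans ?_
  rw [mfderiv_orbitMap_mul_left, mfderiv_orbitMap_mul_left, hgN b v w, ← hinv a (b • x), mul_smul]

end Homogeneous

/-! ### Invariant measures on compact groups and their quotients. -/

section InvariantMeasure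

variable {G : Type*} [Group G] [TopologicalSpace G] [IsTopologicalGroup G] [CompactSpace G]
  [SecondCountableTopology G] [MeasurableSpace G] [BorelSpace G]

/-- A left invariant probability measure on a compact group is right invariant. -/
theorem isMulRightInvariant_of_compactSpace (μ : Measure G)
    [IsProbabilityMeasure μ] [μ.IsHaarMeasure] : μ.IsMulRightInvariant := by
  refine ⟨fun b => ?_⟩
  have hm : Measurable (fun a : G => a * b) := (continuous_mul_const b).measurable
  have h1 : IsProbabilityMeasure (μ.map (· * b)) := Measure.isProbabilityMeasure_map hm.aemeasurable
  have h2 : (μ.map (· * b)).IsHaarMeasure := by infer_instance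
  -- A right translate of μ is again a left Haar probability measure, and there is only one.
  exact Measure.isHaarMeasure_eq_of_isProbabilityMeasure _ _

variable {H : Subgroup G} [MeasurableSpace (G ⧸ H)] [BorelSpace (G ⧸ H)]

/-- Uniqueness of the invariant measure on a homogeneous space of a compact group. -/
theorem eq_smul_map_mk_of_invariant (μ : Measure G) [IsProbabilityMeasure μ]
    [μ.IsMulRightInvariant] (ν : Measure (G ⧸ H)) [IsFiniteMeasure ν]
    (hν : ∀ a : G, ν.map (fun x => a • x) = ν) :
    ν = ν univ • μ.map (QuotientGroup.mk : G → G ⧸ H) := by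
  refine Measure.ext fun A hA => ?_
  have hmk : Measurable (QuotientGroup.mk : G → G ⧸ H) := QuotientGroup.continuous_mk.measurable
  have hact : Measurable (fun p : G × (G ⧸ H) => p.1 • p.2) := continuous_smul.measurable
  have hind : Measurable (fun p : G × (G ⧸ H) => A.indicator (1 : G ⧸ H → ℝ≥0∞) (p.1 • p.2)) :=
    (measurable_one.indicator hA).comp hact
  have h1 : ∀ a : G, ∫⁻ x, A.indicator (1 : G ⧸ H → ℝ≥0∞) (a • x) ∂ν = ν A := by
    intro a
    have ha : Measurable (fun x : G ⧸ H => a • x) := (continuous_const_smul a).measurable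
    rw [← lintegral_indicator_one hA, ← lintegral_map (measurable_one.indicator hA) ha, hν a]
  have h2 : ∀ x : G ⧸ H, ∫⁻ a, A.indicator (1 : G ⧸ H → ℝ≥0∞) (a • x) ∂μ =
      μ.map (QuotientGroup.mk : G → G ⧸ H) A := by
    intro x
    obtain ⟨b, rfl⟩ := QuotientGroup.mk_surjective x
    have := lintegral_mul_right_eq_self (μ := μ)
      (fun a : G => A.indicator (1 : G ⧸ H → ℝ≥0∞) (QuotientGroup.mk a)) b
    refine this.trans ?_
    rw [← lintegral_indicator_one hA, lintegral_map (measurable_one.indicator hA) hmk]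
  -- Fubini for the indicator of `a • x ∈ A`: the inner integral over `x` is constant in `a` by
  -- invariance of ν, the one over `a` is constant in `x` by right invariance of μ.
  have h3 := lintegral_lintegral_swap (μ := μ) (ν := ν)
    (f := fun a x => A.indicator (1 : G ⧸ H → ℝ≥0∞) (a • x)) hind.aemeasurable
  simp only [h1, h2, lintegral_const, measure_univ, mul_one] at h3
  rw [h3, Measure.smul_apply, smul_eq_mul, mul_comm]

end InvariantMeasure

/-! ### The volume of an orbit in terms of Haar measure. -/

section RiemannianVolume

variable {k d m : ℕ} {G : Type*} [Group G] [TopologicalSpace G] [IsTopologicalGroup G]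
  [CompactSpace G] [SecondCountableTopology G] [MeasurableSpace G] [BorelSpace G]
  [ChartedSpace (EuclideanSpace ℝ (Fin k)) G] [LieGroup (𝓡 k) ∞ G]
  {H : Subgroup G}
  [ChartedSpace (EuclideanSpace ℝ (Fin d)) (G ⧸ H)] [IsManifold (𝓡 d) ∞ (G ⧸ H)]
  [MeasurableSpace (G ⧸ H)] [BorelSpace (G ⧸ H)]
  {M : Type*} [TopologicalSpace M] [ChartedSpace (EuclideanSpace ℝ (Fin m)) M]
  [IsManifold (𝓡 m) ∞ M] [MulAction G M] [ContMDiffSMul (𝓡 k) (𝓡 m) ∞ G M]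

/-- The volume of an orbit metric is a multiple of the image of the Haar measure. -/
theorem IsOrbitMetric.exists_riemannianVolume_eq {g : SmoothMetric m M}
    (hinv : IsInvariantMetric G g) {x : M} (hGH : IsHomogeneousStructure k d H)
    {gN : SmoothMetric d (G ⧸ H)} (hgN : IsOrbitMetric k g x gN)
    (μ : Measure G) [IsProbabilityMeasure μ] [μ.IsMulRightInvariant] :
    ∃ c : ℝ≥0∞, c ≠ 0 ∧ c ≠ ⊤ ∧
      riemannianVolume gN = c • μ.map (QuotientGroup.mk : G → G ⧸ H) := by
  have hfin := isFiniteMeasure_riemannianVolume gN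
  refine ⟨riemannianVolume gN univ, ?_, measure_ne_top _ _, ?_⟩
  · exact fun h => riemannianVolume_ne_zero gN (Measure.measure_univ_eq_zero.1 h)
  · refine eq_smul_map_mk_of_invariant μ _ fun a => ?_
    exact map_riemannianVolume gN (F := fun y => a • y) (F' := fun y => a⁻¹ • y)
      (hGH.contMDiff_smul a) (hGH.contMDiff_smul a⁻¹) (inv_smul_smul a) (smul_inv_smul a)
      (hgN.inner_smul hinv hGH a) (hgN.inner_smul hinv hGH a⁻¹)

end RiemannianVolume

/-! ### Averages over a subgroup and descent of measurability. -/

section Average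

variable {G : Type*} [Group G] [TopologicalSpace G] [IsTopologicalGroup G] [CompactSpace G]
  [SecondCountableTopology G] [MeasurableSpace G] [BorelSpace G] {K : Subgroup G}

/-- The average of a function on `G` over the right action of the subgroup `K`. -/
def rightAverage (κ : Measure K) (w : G → ℝ) (a : G) : ℝ := ∫ b : K, w (a * b) ∂κ

theorem rightAverage_mul (κ : Measure K) [κ.IsMulLeftInvariant] (w : G → ℝ) (a : G) (b : K) :
    rightAverage κ w (a * b) = rightAverage κ w a := by
  have := integral_mul_left_eq_self (μ := κ) (fun c : K => w (a * c)) b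
  simpa [rightAverage, mul_assoc] using this

/-- Each slice with fixed second factor is a right translation. Pulling back along this map turns a
statement valid almost everywhere on G into one valid almost everywhere on almost every coset of K.
-/
theorem measurePreserving_mul_coe (μ : Measure G) [IsProbabilityMeasure μ]
    [μ.IsMulRightInvariant] (κ : Measure K) [IsProbabilityMeasure κ] :
    MeasurePreserving (fun p : G × K => p.1 * (p.2 : G)) (μ.prod κ) μ := by
  have hm : Measurable (fun p : G × K => p.1 * (p.2 : G)) := by fun_prop
  refine ⟨hm, Measure.ext fun A hA => ?_⟩
  rw [Measure.map_apply hm hA, Measure.prod_apply_symm (hm hA)]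
  have : ∀ b : K, μ ((fun a => (a, b)) ⁻¹' ((fun p : G × K => p.1 * (p.2 : G)) ⁻¹' A)) = μ A :=
    fun b => measure_preimage_mul_right μ (b : G) A
  simp [this]

/-- Integration against a right `K`-invariant function only sees the average over `K`. -/
theorem integral_mul_rightAverage (μ : Measure G) [IsProbabilityMeasure μ]
    [μ.IsMulRightInvariant] (κ : Measure K) [IsProbabilityMeasure κ] {u w : G → ℝ}
    (hu : ∀ (a : G) (b : K), u (a * b) = u a) (huw : Integrable (fun a => u a * w a) μ) :
    ∫ a, u a * rightAverage κ w a ∂μ = ∫ a, u a * w a ∂μ := by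
  have hp := measurePreserving_mul_coe μ κ (K := K)
  have h1 : Integrable (fun p : G × K => u (p.1 * p.2) * w (p.1 * p.2)) (μ.prod κ) :=
    hp.integrable_comp_of_integrable huw
  have h2 : ∫ p : G × K, u (p.1 * p.2) * w (p.1 * p.2) ∂(μ.prod κ) = ∫ a, u a * w a ∂μ := by
    have := integral_map (μ := μ.prod κ) (φ := fun p : G × K => p.1 * (p.2 : G))
      (f := fun a => u a * w a) hp.measurable.aemeasurable
      (by rw [hp.map_eq]; exact huw.aestronglyMeasurable)
    rw [hp.map_eq] at this
    exact this.symm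
  rw [← h2, integral_prod _ h1]
  simp only [hu, integral_const_mul]
  rfl

theorem stronglyMeasurable_rightAverage (κ : Measure K) [SFinite κ] {w : G → ℝ}
    (hw : StronglyMeasurable w) : StronglyMeasurable (rightAverage κ w) := by
  have hm : Measurable (fun p : G × K => p.1 * (p.2 : G)) := by fun_prop
  exact StronglyMeasurable.integral_prod_right (f := fun (a : G) (b : K) => w (a * b))
    (hw.comp_measurable hm)

variable [T2Space G] [hK : IsClosed (K : Set G)] [MeasurableSpace (G ⧸ K)] [BorelSpace (G ⧸ K)]

theorem exists_measurable_comp_mk_eq_rightAverage (κ : Measure K) [IsProbabilityMeasure κ]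
    [κ.IsMulLeftInvariant] {w : G → ℝ} (hw : StronglyMeasurable w) :
    ∃ ψ : G ⧸ K → ℝ, Measurable ψ ∧ ∀ a : G, ψ (QuotientGroup.mk a) = rightAverage κ w a := by
  have hmk : Measurable (QuotientGroup.mk : G → G ⧸ K) := QuotientGroup.continuous_mk.measurable
  have hdesc : ∀ a b : G, (QuotientGroup.mk a : G ⧸ K) = QuotientGroup.mk b →
      rightAverage κ w a = rightAverage κ w b := by
    intro a b hab
    have h := rightAverage_mul κ w a ⟨a⁻¹ * b, QuotientGroup.eq.1 hab⟩
    simpa using h.symm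
  have hcomp : ∀ a : G, (fun x : G ⧸ K => rightAverage κ w x.out) (QuotientGroup.mk a) =
      rightAverage κ w a := fun a => hdesc _ _ (QuotientGroup.out_eq' _)
  -- G is compact Hausdorff and second countable, hence Polish; Borel measurability then descends
  -- along a Borel surjection by the separation theorem for analytic sets.
  have hpol : PolishSpace G := by
    let _ := TopologicalSpace.metrizableSpaceMetric G
    infer_instance
  refine ⟨fun x => rightAverage κ w x.out, ?_, hcomp⟩
  refine (Measurable.measurable_comp_iff_of_surjective hmk QuotientGroup.mk_surjective).1 ?_
  rw [show (fun x : G ⧸ K => rightAverage κ w x.out) ∘ QuotientGroup.mk = rightAverage κ w from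
    funext hcomp]
  exact (stronglyMeasurable_rightAverage κ hw).measurable

/-- A property that holds almost everywhere on `G` after composition with the projection holds
almost everywhere on `G ⧸ K`. -/
theorem ae_map_mk_of_ae (μ : Measure G) [IsProbabilityMeasure μ]
    [μ.IsMulRightInvariant] (κ : Measure K) [IsProbabilityMeasure κ] [κ.IsMulLeftInvariant]
    {P : G ⧸ K → Prop} (h : ∀ᵐ a : G ∂μ, P (QuotientGroup.mk a)) :
    ∀ᵐ x ∂(μ.map (QuotientGroup.mk : G → G ⧸ K)), P x := by
  have hmk : Measurable (QuotientGroup.mk : G → G ⧸ K) := QuotientGroup.continuous_mk.measurable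
  -- The set where P fails on G ⧸ K is not known to be measurable, and N need not be a union of
  -- cosets. The average of the indicator of N repairs both: it descends to a measurable function,
  -- vanishes almost everywhere, and equals 1 on every coset where P fails.
  obtain ⟨N, hNsub, hN, hN0⟩ := exists_measurable_superset_of_null (ae_iff.1 h)
  obtain ⟨ψ, hψm, hψ⟩ := exists_measurable_comp_mk_eq_rightAverage κ
    (stronglyMeasurable_one.indicator hN : StronglyMeasurable (N.indicator (1 : G → ℝ)))
  have h1 : ∀ᵐ a ∂μ, rightAverage κ (N.indicator (1 : G → ℝ)) a = 0 := by
    have hp := measurePreserving_mul_coe μ κ (K := K)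
    have hN' : ∀ᵐ a ∂μ, a ∉ N := measure_eq_zero_iff_ae_notMem.1 hN0
    filter_upwards [Measure.ae_ae_of_ae_prod (hp.quasiMeasurePreserving.ae hN')] with a ha
    refine integral_eq_zero_of_ae ?_
    filter_upwards [ha] with b hb
    simp [hb]
  have h2 : ∀ a : G, ¬ P (QuotientGroup.mk a) →
      rightAverage κ (N.indicator (1 : G → ℝ)) a = 1 := by
    intro a ha
    have : ∀ b : K, N.indicator (1 : G → ℝ) (a * b) = 1 := by
      intro b
      have : a * (b : G) ∈ N := hNsub (by simpa [QuotientGroup.mk_mul_of_mem a b.2] using ha)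
      simp [this]
    simp [rightAverage, this]
  have h3 : ∀ᵐ x ∂(μ.map (QuotientGroup.mk : G → G ⧸ K)), ψ x = 0 := by
    refine (ae_map_iff hmk.aemeasurable (measurableSet_eq_fun hψm measurable_const)).2 ?_
    simpa only [hψ] using h1
  filter_upwards [h3] with x hx
  obtain ⟨a, rfl⟩ := QuotientGroup.mk_surjective x
  by_contra ha
  rw [hψ, h2 a ha] at hx
  exact one_ne_zero hx

/-- If a function on `G ⧸ K` is almost everywhere measurable after composition with the
projection from `G`, then it is almost everywhere measurable. -/
theorem aestronglyMeasurable_of_comp_mk (μ : Measure G) [IsProbabilityMeasure μ]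
    [μ.IsMulRightInvariant] (κ : Measure K) [IsProbabilityMeasure κ] [κ.IsMulLeftInvariant]
    {ψ : G ⧸ K → ℝ}
    (hψ : AEStronglyMeasurable (fun a : G => ψ (QuotientGroup.mk a)) μ) :
    AEStronglyMeasurable ψ (μ.map (QuotientGroup.mk : G → G ⧸ K)) := by
  have hp := measurePreserving_mul_coe μ κ (K := K)
  obtain ⟨ψ', hψ'm, hψ'⟩ :=
    exists_measurable_comp_mk_eq_rightAverage κ hψ.stronglyMeasurable_mk
  refine ⟨ψ', hψ'm.stronglyMeasurable, ae_map_mk_of_ae μ κ ?_⟩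
  -- On almost every coset the measurable representative agrees almost everywhere with the constant
  -- value of ψ, so averaging it over K returns that value.
  have h2 := Measure.ae_ae_of_ae_prod (hp.quasiMeasurePreserving.ae hψ.ae_eq_mk)
  filter_upwards [h2] with a ha
  have h3 : ∀ᵐ b : K ∂κ, hψ.mk _ (a * (b : G)) = ψ (QuotientGroup.mk a) := by
    filter_upwards [ha] with b hb
    rw [← hb]
    exact congrArg ψ (QuotientGroup.mk_mul_of_mem a b.2)
  rw [hψ', rightAverage, integral_congr_ae h3]
  simp

end Average

/-! ### Smooth dependence of integrals on a parameter. -/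

section ParametricIntegral

variable {E : Type} [NormedAddCommGroup E] [NormedSpace ℝ E] [FiniteDimensional ℝ E]
  {k : ℕ} {G : Type*} [TopologicalSpace G] [ChartedSpace (EuclideanSpace ℝ (Fin k)) G]
  [IsManifold (𝓡 k) ∞ G]
  {Z : Type*} [TopologicalSpace Z] [CompactSpace Z] [SecondCountableTopology Z]
  [MeasurableSpace Z] [BorelSpace Z] (κ : Measure Z) [IsFiniteMeasure κ] {ι : Z → G}

/-- The partial derivative of an admissible integrand is again admissible, which drives the
induction on the order of differentiability. -/
theorem contMDiffOn_fderiv_left {F' : Type*} [NormedAddCommGroup F'] [NormedSpace ℝ F']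
    {U : Set E} (hU : IsOpen U) {F : E × G → F'}
    (hF : ContMDiffOn (𝓘(ℝ, E).prod (𝓡 k)) 𝓘(ℝ, F') ∞ F (U ×ˢ univ)) :
    ContMDiffOn (𝓘(ℝ, E).prod (𝓡 k)) 𝓘(ℝ, E →L[ℝ] F') ∞
      (fun p : E × G => fderiv ℝ (fun y => F (y, p.2)) p.1) (U ×ˢ univ) := by
  intro p hp
  refine ContMDiffAt.contMDiffWithinAt ?_
  have hopen : U ×ˢ (univ : Set G) ∈ 𝓝 p := (hU.prod isOpen_univ).mem_nhds hp
  have h1 : ContMDiffAt ((𝓘(ℝ, E).prod (𝓡 k)).prod 𝓘(ℝ, E)) 𝓘(ℝ, F') ∞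
      (Function.uncurry fun (q : E × G) (y : E) => F (y, q.2)) (p, p.1) := by
    have hF' : ContMDiffAt (𝓘(ℝ, E).prod (𝓡 k)) 𝓘(ℝ, F') ∞ F (p.1, p.2) := hF.contMDiffAt hopen
    exact ContMDiffAt.comp (p, p.1) (g := F) (f := fun r : (E × G) × E => (r.2, r.1.2)) hF'
      (contMDiffAt_snd.prodMk (contMDiffAt_snd.comp _ contMDiffAt_fst))
  have h2 := ContMDiffAt.mfderiv (m := ∞) (fun (q : E × G) (y : E) => F (y, q.2)) Prod.fst h1
    contMDiffAt_fst (by simp)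
  have h3 := inTangentCoordinates_model_space (I := 𝓘(ℝ, E)) (I' := 𝓘(ℝ, F')) (Prod.fst : E × G → E)
    (fun x => F (x.1, x.2)) (fun x => mfderiv 𝓘(ℝ, E) 𝓘(ℝ, F') (fun y => F (y, x.2)) x.1) p
  have h4 := Eq.subst (motive := fun u => ContMDiffAt (𝓘(ℝ, E).prod (𝓡 k)) 𝓘(ℝ, E →L[ℝ] F') ∞ u p)
    h3 h2
  simpa only [mfderiv_eq_fderiv] using h4

theorem hasFDerivAt_integral_of_contMDiffOn (hι : Continuous ι)
    {F' : Type*} [NormedAddCommGroup F'] [NormedSpace ℝ F']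
    {U : Set E} (hU : IsOpen U) {F : E × G → F'}
    (hF : ContMDiffOn (𝓘(ℝ, E).prod (𝓡 k)) 𝓘(ℝ, F') ∞ F (U ×ˢ univ)) {y : E} (hy : y ∈ U) :
    HasFDerivAt (fun y => ∫ b, F (y, ι b) ∂κ)
      (∫ b, fderiv ℝ (fun y => F (y, ι b)) y ∂κ) y := by
  have hD := (contMDiffOn_fderiv_left hU hF).continuousOn
  obtain ⟨r, hr, hrU⟩ := Metric.nhds_basis_closedBall.mem_iff.1 (hU.mem_nhds hy)
  have hcont : ∀ x ∈ U, Continuous fun b => F (x, ι b) := fun x hx =>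
    hF.continuousOn.comp_continuous (by fun_prop) fun b => ⟨hx, mem_univ _⟩
  have hcontD : ∀ x ∈ U, Continuous fun b => fderiv ℝ (fun y => F (y, ι b)) x := fun x hx =>
    hD.comp_continuous (f := fun b => (x, ι b)) (by fun_prop) fun b => ⟨hx, mem_univ _⟩
  have hcontD2 : ContinuousOn (fun p : E × Z => fderiv ℝ (fun y => F (y, ι p.2)) p.1)
      (Metric.closedBall y r ×ˢ univ) :=
    hD.comp (f := fun p : E × Z => (p.1, ι p.2)) (by fun_prop)
      fun p hp => ⟨hrU hp.1, mem_univ _⟩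
  -- The dominating function is a constant, the maximum of the derivative over a compact ball times
  -- the compact space Z.
  obtain ⟨C, hC⟩ := ((isCompact_closedBall y r).prod isCompact_univ).bddAbove_image hcontD2.norm
  refine hasFDerivAt_integral_of_dominated_of_fderiv_le (s := Metric.ball y r) (bound := fun _ => C)
    (F' := fun x b => fderiv ℝ (fun y => F (y, ι b)) x) (Metric.ball_mem_nhds y hr) ?_ ?_ ?_ ?_ ?_ ?_
  · filter_upwards [hU.mem_nhds hy] with x hx
    exact (hcont x hx).aestronglyMeasurable
  · exact (hcont y hy).integrable_of_hasCompactSupport (HasCompactSupport.of_compactSpace _)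
  · exact (hcontD y hy).aestronglyMeasurable
  · refine ae_of_all _ fun b x hx => ?_
    have hxb : (x, b) ∈ Metric.closedBall y r ×ˢ (univ : Set Z) :=
      ⟨Metric.ball_subset_closedBall hx, mem_univ _⟩
    exact hC (mem_image_of_mem _ hxb)
  · exact integrable_const C
  · refine ae_of_all _ fun b x hx => ?_
    have hxU : x ∈ U := hrU (Metric.ball_subset_closedBall hx)
    have h1 : ContMDiffAt 𝓘(ℝ, E) 𝓘(ℝ, F') ∞ (fun y => F (y, ι b)) x :=
      ContMDiffAt.comp x (g := F) (f := fun y => (y, ι b))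
        (hF.contMDiffAt ((hU.prod isOpen_univ).mem_nhds ⟨hxU, mem_univ _⟩))
        (contMDiffAt_id.prodMk contMDiffAt_const)
    exact ((contMDiffAt_iff_contDiffAt.1 h1).differentiableAt (by simp)).hasFDerivAt

/-- The derivative is an integral of the same kind with values in `E →L[ℝ] F'`, so the target `F'`
must vary in the induction and is quantified after `n`. -/
theorem contDiffOn_integral_of_contMDiffOn (hι : Continuous ι) {U : Set E} (hU : IsOpen U)
    (n : ℕ) : ∀ {F' : Type} [NormedAddCommGroup F'] [NormedSpace ℝ F'] {F : E × G → F'},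
    ContMDiffOn (𝓘(ℝ, E).prod (𝓡 k)) 𝓘(ℝ, F') ∞ F (U ×ˢ univ) →
    ContDiffOn ℝ n (fun y => ∫ b, F (y, ι b) ∂κ) U := by
  induction n with
  | zero =>
    intro F' _ _ F hF
    refine contDiffOn_zero.2 fun y hy => ?_
    exact (hasFDerivAt_integral_of_contMDiffOn κ hι hU hF hy).continuousAt.continuousWithinAt
  | succ n ih =>
    intro F' _ _ F hF
    rw [show ((n + 1 : ℕ) : ℕ∞ω) = (n : ℕ∞ω) + 1 from rfl]
    refine (contDiffOn_succ_iff_fderiv_of_isOpen hU).2 ⟨fun y hy => ?_, fun h => absurd h (WithTop.natCast_ne_top n), ?_⟩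
    · exact (hasFDerivAt_integral_of_contMDiffOn κ hι hU hF
        hy).differentiableAt.differentiableWithinAt
    · refine (ih (contMDiffOn_fderiv_left hU hF)).congr fun y hy => ?_
      exact (hasFDerivAt_integral_of_contMDiffOn κ hι hU hF hy).fderiv

end ParametricIntegral

/-! ### Smoothness of averages and differentiation under the average. -/

section Average

variable {k : ℕ} {G : Type*} [Group G] [TopologicalSpace G] [IsTopologicalGroup G] [CompactSpace G]
  [SecondCountableTopology G] [MeasurableSpace G] [BorelSpace G]
  [ChartedSpace (EuclideanSpace ℝ (Fin k)) G] [LieGroup (𝓡 k) ∞ G] {K : Subgroup G}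
  [hK : IsClosed (K : Set G)] (κ : Measure K) [IsFiniteMeasure κ]

theorem contMDiffOn_chart_symm_mul {w : G → ℝ} (hw : ContMDiff (𝓡 k) 𝓘(ℝ, ℝ) ∞ w) (a : G) :
    ContMDiffOn (𝓘(ℝ, EuclideanSpace ℝ (Fin k)).prod (𝓡 k)) 𝓘(ℝ, ℝ) ∞
      (fun p : EuclideanSpace ℝ (Fin k) × G =>
        w ((chartAt (EuclideanSpace ℝ (Fin k)) a).symm p.1 * p.2))
      ((chartAt (EuclideanSpace ℝ (Fin k)) a).target ×ˢ univ) := by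
  refine hw.comp_contMDiffOn (ContMDiffOn.mul ?_ contMDiffOn_snd)
  exact contMDiffOn_chart_symm.comp contMDiffOn_fst fun p hp => hp.1

theorem contMDiff_rightAverage {w : G → ℝ} (hw : ContMDiff (𝓡 k) 𝓘(ℝ, ℝ) ∞ w) :
    ContMDiff (𝓡 k) 𝓘(ℝ, ℝ) ∞ (rightAverage κ w) := by
  intro a
  have : CompactSpace K := isCompact_iff_compactSpace.1 hK.isCompact
  have : SecondCountableTopology K := TopologicalSpace.Subtype.secondCountableTopology _
  set c := chartAt (EuclideanSpace ℝ (Fin k)) a with hc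
  have h1 : ContDiffOn ℝ ∞ (fun y => rightAverage κ w (c.symm y)) c.target :=
    contDiffOn_infty.2 fun n => contDiffOn_integral_of_contMDiffOn κ continuous_subtype_val
      c.open_target n (contMDiffOn_chart_symm_mul hw a)
  have h2 : ContMDiffOn (𝓡 k) 𝓘(ℝ, ℝ) ∞ ((fun y => rightAverage κ w (c.symm y)) ∘ c) c.source :=
    (contMDiffOn_iff_contDiffOn.2 h1).comp contMDiffOn_chart c.mapsTo
  refine (h2.congr fun b hb => ?_).contMDiffAt (c.open_source.mem_nhds (mem_chart_source _ a))
  simp [c.left_inv hb]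

/-- The average may be differentiated under the integral sign. -/
theorem differential_rightAverage {w : G → ℝ} (hw : ContMDiff (𝓡 k) 𝓘(ℝ, ℝ) ∞ w) (a : G)
    (v : TangentSpace (𝓡 k) a) :
    differential (rightAverage κ w) a v = ∫ b : K, differential (fun c : G => w (c * b)) a v ∂κ := by
  have : CompactSpace K := isCompact_iff_compactSpace.1 hK.isCompact
  have : SecondCountableTopology K := TopologicalSpace.Subtype.secondCountableTopology _
  set c := chartAt (EuclideanSpace ℝ (Fin k)) a with hc
  have hac : c a ∈ c.target := c.map_source (mem_chart_source _ a)
  have hca : MDifferentiableAt (𝓡 k) (𝓡 k) c a :=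
    (mdifferentiable_chart (I := 𝓡 k) a).mdifferentiableAt (mem_chart_source _ a)
  have hw' := contMDiffOn_chart_symm_mul hw a
  obtain ⟨v', hv'⟩ : ∃ v' : EuclideanSpace ℝ (Fin k), v' = mfderiv (𝓡 k) (𝓡 k) c a v := ⟨_, rfl⟩
  -- Differentials at `a` are ordinary derivatives in the chart along one fixed vector; this applies
  -- to the average and to each integrand alike.
  have key : ∀ u : G → ℝ, DifferentiableAt ℝ (fun y => u (c.symm y)) (c a) →
      differential u a v = fderiv ℝ (fun y => u (c.symm y)) (c a) v' := by
    intro u hu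
    have h1 : u =ᶠ[𝓝 a] (fun y => u (c.symm y)) ∘ c := by
      filter_upwards [c.open_source.mem_nhds (mem_chart_source _ a)] with b hb
      simp [c.left_inv hb]
    have h2 := mfderiv_comp a (I := 𝓡 k) (I' := 𝓡 k) (I'' := 𝓘(ℝ, ℝ))
      (g := fun y => u (c.symm y)) (f := c) (mdifferentiableAt_iff_differentiableAt.2 hu) hca
    rw [mfderiv_eq_fderiv] at h2
    rw [differential, h1.mfderiv_eq, hv']
    exact DFunLike.congr_fun h2 v
  have hder := hasFDerivAt_integral_of_contMDiffOn κ (ι := ((↑) : K → G)) continuous_subtype_val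
    c.open_target hw' hac
  have hcontD : Continuous fun b : K => fderiv ℝ (fun y => w (c.symm y * (b : G))) (c a) :=
    (contMDiffOn_fderiv_left c.open_target hw').continuousOn.comp_continuous
      (f := fun b : K => (c a, (b : G))) (by fun_prop) fun b => ⟨hac, mem_univ _⟩
  rw [key _ hder.differentiableAt, show fderiv ℝ (fun y => rightAverage κ w (c.symm y)) (c a) = _
    from hder.fderiv, ContinuousLinearMap.integral_apply]
  · refine integral_congr_ae (ae_of_all _ fun b => ?_)
    refine (key (fun x => w (x * b)) ?_).symm
    have h1 : ContMDiffAt (𝓡 k) 𝓘(ℝ, ℝ) ∞ (fun y => w (c.symm y * (b : G))) (c a) :=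
      ContMDiffAt.comp (c a) (f := fun y => (y, (b : G)))
        (hw'.contMDiffAt ((c.open_target.prod isOpen_univ).mem_nhds ⟨hac, mem_univ _⟩))
        (contMDiffAt_id.prodMk contMDiffAt_const)
    exact (contMDiffAt_iff_contDiffAt.1 h1).differentiableAt (by simp)
  · exact hcontD.integrable_of_hasCompactSupport (HasCompactSupport.of_compactSpace _)

end Average

/-! ### Left invariant derivatives and the adjoint action. -/

section ChainRule

variable {E E' E'' H H' H'' : Type*} [NormedAddCommGroup E] [NormedSpace ℝ E]
  [NormedAddCommGroup E'] [NormedSpace ℝ E'] [NormedAddCommGroup E''] [NormedSpace ℝ E'']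
  [TopologicalSpace H] [TopologicalSpace H'] [TopologicalSpace H'']
  {I : ModelWithCorners ℝ E H} {I' : ModelWithCorners ℝ E' H'} {I'' : ModelWithCorners ℝ E'' H''}
  {X Y Z : Type*} [TopologicalSpace X] [ChartedSpace H X] [TopologicalSpace Y] [ChartedSpace H' Y]
  [TopologicalSpace Z] [ChartedSpace H'' Z]

/-- The chain rule, with the base point of the outer derivative given up to equality. -/
theorem mfderiv_comp_apply_of_base_eq {f : X → Y} {g : Y → Z} {x : X} {y : Y} (h : f x = y)
    (hg : MDifferentiableAt I' I'' g y) (hf : MDifferentiableAt I I' f x) (v : E) :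
    (mfderiv I I'' (fun x => g (f x)) x : E →L[ℝ] E'') v =
      (mfderiv I' I'' g y : E' →L[ℝ] E'') ((mfderiv I I' f x : E →L[ℝ] E') v) := by
  subst h
  exact DFunLike.congr_fun (mfderiv_comp x hg hf) v

end ChainRule

section LeftDeriv

variable {k d m : ℕ} {G : Type*} [Group G] [TopologicalSpace G]
  [ChartedSpace (EuclideanSpace ℝ (Fin k)) G] [LieGroup (𝓡 k) ∞ G]

/-- The derivative at `a` of the function `w` on `G` in the direction of the left invariant
vector field determined by `X`. -/
def leftDeriv (w : G → ℝ) (a : G) : GroupLieAlgebra (𝓡 k) G →ₗ[ℝ] ℝ :=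
  ((mfderiv (𝓡 k) 𝓘(ℝ, ℝ) w a : EuclideanSpace ℝ (Fin k) →L[ℝ] ℝ).comp
    (mfderiv (𝓡 k) (𝓡 k) (fun c : G => a * c) (1 : G) :
      EuclideanSpace ℝ (Fin k) →L[ℝ] EuclideanSpace ℝ (Fin k))).toLinearMap

theorem leftDeriv_apply (w : G → ℝ) (a : G) (X : GroupLieAlgebra (𝓡 k) G) :
    leftDeriv w a X = differential w a (mulInvariantVectorField X a) := rfl

theorem mdifferentiableAt_const_mul (a b : G) :
    MDifferentiableAt (𝓡 k) (𝓡 k) (fun c : G => a * c) b :=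
  (contMDiff_mul_left (I := 𝓡 k) (n := ∞) (a := a)).mdifferentiableAt (by simp)

theorem mdifferentiableAt_mul_const (a b : G) :
    MDifferentiableAt (𝓡 k) (𝓡 k) (fun c : G => c * a) b :=
  (contMDiff_mul_right (I := 𝓡 k) (n := ∞) (a := a)).mdifferentiableAt (by simp)

theorem mdifferentiableAt_conj (a b : G) :
    MDifferentiableAt (𝓡 k) (𝓡 k) (fun c : G => a * c * a⁻¹) b :=
  (mdifferentiableAt_mul_const a⁻¹ (a * b)).comp b (mdifferentiableAt_const_mul a b)

theorem leftDeriv_eq {w : G → ℝ} (hw : ContMDiff (𝓡 k) 𝓘(ℝ, ℝ) ∞ w) (a : G)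
    (X : GroupLieAlgebra (𝓡 k) G) :
    leftDeriv w a X = differential (fun c => w (a * c)) (1 : G) X :=
  (mfderiv_comp_apply_of_base_eq (mul_one a) (hw.mdifferentiableAt (by simp))
    (mdifferentiableAt_const_mul a 1) X).symm

/-- Right translation acts on left invariant vector fields by the adjoint action. -/
theorem leftDeriv_comp_mul_right {w : G → ℝ} (hw : ContMDiff (𝓡 k) 𝓘(ℝ, ℝ) ∞ w) (a b : G)
    (X : GroupLieAlgebra (𝓡 k) G) :
    leftDeriv (fun c => w (c * b)) a X = leftDeriv w (a * b) (adjointAction b⁻¹ X) := by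
  have hwb : ContMDiff (𝓡 k) 𝓘(ℝ, ℝ) ∞ (fun c => w (c * b)) :=
    hw.comp (contMDiff_mul_right (a := b))
  have hwab : ContMDiff (𝓡 k) 𝓘(ℝ, ℝ) ∞ (fun c => w (a * b * c)) :=
    hw.comp (contMDiff_mul_left (a := a * b))
  rw [leftDeriv_eq hwb, leftDeriv_eq hw]
  have h := mfderiv_comp_apply_of_base_eq (I := 𝓡 k) (I' := 𝓡 k) (I'' := 𝓘(ℝ, ℝ))
    (f := fun c : G => b⁻¹ * c * b⁻¹⁻¹) (g := fun c => w (a * b * c)) (x := 1) (y := 1)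
    (by simp) (hwab.mdifferentiableAt (by simp)) (mdifferentiableAt_conj b⁻¹ 1) X
  refine Eq.trans ?_ h
  have : (fun c => w (a * c * b)) = fun c => w (a * b * (b⁻¹ * c * b⁻¹⁻¹)) := by
    funext c
    congr 1
    group
  rw [this]
  rfl

theorem adjointAction_mul (a b : G) (X : GroupLieAlgebra (𝓡 k) G) :
    adjointAction (a * b) X = adjointAction a (adjointAction b X) := by
  have h := mfderiv_comp_apply_of_base_eq (I := 𝓡 k) (I' := 𝓡 k) (I'' := 𝓡 k)
    (f := fun c : G => b * c * b⁻¹) (g := fun c : G => a * c * a⁻¹) (x := 1) (y := 1)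
    (by simp) (mdifferentiableAt_conj a 1) (mdifferentiableAt_conj b 1) X
  refine Eq.trans ?_ h
  have : (fun c : G => a * b * c * (a * b)⁻¹) = fun c : G => a * (b * c * b⁻¹) * a⁻¹ := by
    funext c
    group
  rw [adjointAction, this]
  rfl

theorem adjointAction_one (X : GroupLieAlgebra (𝓡 k) G) :
    adjointAction (1 : G) X = X := by
  have : (fun c : G => (1 : G) * c * (1 : G)⁻¹) = id := by
    funext c
    simp
  rw [adjointAction, this, mfderiv_id]
  rfl

theorem continuous_leftDeriv {w : G → ℝ} (hw : ContMDiff (𝓡 k) 𝓘(ℝ, ℝ) ∞ w)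
    (X : GroupLieAlgebra (𝓡 k) G) : Continuous fun a => leftDeriv w a X := by
  have : LieGroup (𝓡 k) (minSmoothness ℝ 3) G := LieGroup.of_le (n := ∞) (by simpa using ENat.LEInfty.out)
  have h1 := (contMDiff_mulInvariantVectorField (I := 𝓡 k) X).continuous
  have h2 := hw.continuous_tangentMap (by simp)
  have h3 := (tangentBundleModelSpaceHomeomorph 𝓘(ℝ, ℝ)).continuous
  exact (continuous_snd.comp h3).comp (h2.comp h1)

variable {H : Subgroup G}
  [ChartedSpace (EuclideanSpace ℝ (Fin d)) (G ⧸ H)] [IsManifold (𝓡 d) ∞ (G ⧸ H)]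

/-- The tangent vector at `a H` which is the image of the left invariant vector field determined
by `X`. -/
def leftVec (k d : ℕ) {G : Type*} [Group G] [TopologicalSpace G]
    [ChartedSpace (EuclideanSpace ℝ (Fin k)) G] (H : Subgroup G) [ChartedSpace (EuclideanSpace ℝ (Fin d)) (G ⧸ H)] (a : G) :
    GroupLieAlgebra (𝓡 k) G →ₗ[ℝ] TangentSpace (𝓡 d) (QuotientGroup.mk a : G ⧸ H) :=
  ((mfderiv (𝓡 k) (𝓡 d) (QuotientGroup.mk : G → G ⧸ H) a :
      EuclideanSpace ℝ (Fin k) →L[ℝ] EuclideanSpace ℝ (Fin d)).comp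
    (mfderiv (𝓡 k) (𝓡 k) (fun c : G => a * c) (1 : G) :
      EuclideanSpace ℝ (Fin k) →L[ℝ] EuclideanSpace ℝ (Fin k))).toLinearMap

theorem leftVec_apply (a : G) (X : GroupLieAlgebra (𝓡 k) G) :
    leftVec k d H a X = mfderiv (𝓡 k) (𝓡 d) (QuotientGroup.mk : G → G ⧸ H) a
      (mulInvariantVectorField X a) := rfl

theorem leftVec_one (X : GroupLieAlgebra (𝓡 k) G) :
    (leftVec k d H (1 : G) X : EuclideanSpace ℝ (Fin d)) =
      mfderiv (𝓡 k) (𝓡 d) (QuotientGroup.mk : G → G ⧸ H) (1 : G) X := by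
  have : (fun c : G => (1 : G) * c) = id := by
    funext c
    simp
  have h : (mulInvariantVectorField X (1 : G) : EuclideanSpace ℝ (Fin k)) = X := by
    rw [mulInvariantVectorField, this, mfderiv_id]
    rfl
  rw [leftVec_apply, h]

/-- By equivariance of the projection, the vector at `a` is the translate by `a` of the image of X
at the identity coset, which is zero. -/
theorem leftVec_eq_zero (hGH : IsHomogeneousStructure k d H) (a : G)
    {X : GroupLieAlgebra (𝓡 k) G} (hX : X ∈ subgroupLieAlgebra k d H) : leftVec k d H a X = 0 := by
  have h1 := mfderiv_comp_apply_of_base_eq (I := 𝓡 k) (I' := 𝓡 k) (I'' := 𝓡 d)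
    (f := fun c : G => a * c) (g := (QuotientGroup.mk : G → G ⧸ H)) (mul_one a)
    (hGH.1.mdifferentiableAt (by simp)) (mdifferentiableAt_const_mul a 1) X
  have h2 := mfderiv_comp_apply_of_base_eq (I := 𝓡 k) (I' := 𝓡 d) (I'' := 𝓡 d)
    (f := (QuotientGroup.mk : G → G ⧸ H)) (g := fun x : G ⧸ H => a • x) (x := (1 : G)) rfl
    ((hGH.contMDiff_smul a).mdifferentiableAt (by simp)) (hGH.1.mdifferentiableAt (by simp)) X
  have h3 : (mfderiv (𝓡 k) (𝓡 d) (QuotientGroup.mk : G → G ⧸ H) (1 : G) :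
      EuclideanSpace ℝ (Fin k) →L[ℝ] EuclideanSpace ℝ (Fin d)) X = 0 := hX
  rw [h3, map_zero] at h2
  exact h1.symm.trans h2

theorem leftVec_surjective (hGH : IsHomogeneousStructure k d H) (a : G) :
    Function.Surjective (leftVec k d H a) := by
  intro y
  obtain ⟨v, rfl⟩ := hGH.2 a y
  refine ⟨(mfderiv (𝓡 k) (𝓡 k) (fun c : G => a⁻¹ * c) a v : EuclideanSpace ℝ (Fin k)), ?_⟩
  have h := mfderiv_comp_apply_of_base_eq (I := 𝓡 k) (I' := 𝓡 k) (I'' := 𝓡 k)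
    (f := fun c : G => a⁻¹ * c) (g := fun c : G => a * c) (x := a) (y := 1) (inv_mul_cancel a)
    (mdifferentiableAt_const_mul a 1) (mdifferentiableAt_const_mul a⁻¹ a) v
  have h2 : (fun c : G => a * (a⁻¹ * c)) = id := by
    funext c
    simp
  rw [h2, mfderiv_id] at h
  exact congrArg (mfderiv (𝓡 k) (𝓡 d) (QuotientGroup.mk : G → G ⧸ H) a :
      EuclideanSpace ℝ (Fin k) →L[ℝ] EuclideanSpace ℝ (Fin d)) h.symm

theorem differential_leftVec (hGH : IsHomogeneousStructure k d H) {φ : G ⧸ H → ℝ}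
    (hφ : ContMDiff (𝓡 d) 𝓘(ℝ, ℝ) ∞ φ) (a : G) (X : GroupLieAlgebra (𝓡 k) G) :
    differential φ (QuotientGroup.mk a) (leftVec k d H a X) =
      leftDeriv (fun c : G => φ (QuotientGroup.mk c)) a X :=
  (mfderiv_comp_apply_of_base_eq (I := 𝓡 k) (I' := 𝓡 d) (I'' := 𝓘(ℝ, ℝ))
    (f := (QuotientGroup.mk : G → G ⧸ H)) (g := φ) rfl (hφ.mdifferentiableAt (by simp))
    (hGH.1.mdifferentiableAt (by simp)) (mulInvariantVectorField X a)).symm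

variable {M : Type*} [TopologicalSpace M] [ChartedSpace (EuclideanSpace ℝ (Fin m)) M]
  [IsManifold (𝓡 m) ∞ M] [MulAction G M] [ContMDiffSMul (𝓡 k) (𝓡 m) ∞ G M]
  {g : SmoothMetric m M}

theorem mdifferentiableAt_orbitMap (x : M) (a : G) :
    MDifferentiableAt (𝓡 k) (𝓡 m) (fun c : G => c • x) a :=
  (contMDiff_orbitMap x).mdifferentiableAt (by simp)

theorem mdifferentiableAt_const_smul (k : ℕ) {G : Type*} [Group G] [TopologicalSpace G]
    [ChartedSpace (EuclideanSpace ℝ (Fin k)) G] [MulAction G M]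
    [ContMDiffSMul (𝓡 k) (𝓡 m) ∞ G M] (a : G) (x : M) :
    MDifferentiableAt (𝓡 m) (𝓡 m) (fun y : M => a • y) x :=
  (ContMDiffSMul.contMDiff_const_smul (I := 𝓡 k) (I' := 𝓡 m) (n := ∞) a).mdifferentiableAt
    (by simp)

theorem mfderiv_orbitMap_mulInvariantVectorField (x : M) (a : G)
    (X : GroupLieAlgebra (𝓡 k) G) :
    mfderiv (𝓡 k) (𝓡 m) (fun c : G => c • x) a (mulInvariantVectorField X a) =
      mfderiv (𝓡 m) (𝓡 m) (fun y : M => a • y) x (actionField X x) := by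
  have h1 := mfderiv_comp_apply_of_base_eq (I := 𝓡 k) (I' := 𝓡 k) (I'' := 𝓡 m)
    (f := fun c : G => a * c) (g := fun c : G => c • x) (mul_one a)
    (mdifferentiableAt_orbitMap x a) (mdifferentiableAt_const_mul a 1) X
  have h2 := mfderiv_comp_apply_of_base_eq (I := 𝓡 k) (I' := 𝓡 m) (I'' := 𝓡 m)
    (f := fun c : G => c • x) (g := fun y : M => a • y) (x := (1 : G)) (one_smul G x)
    (mdifferentiableAt_const_smul k a x) (mdifferentiableAt_orbitMap x 1) X
  have h3 : (fun c : G => (a * c) • x) = fun c : G => a • c • x := by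
    funext c
    exact mul_smul a c x
  rw [h3] at h1
  exact h1.symm.trans h2

/-- The right-hand side does not involve `a`: this reduces gradients on the orbit to linear algebra
with one form on 𝔤. -/
theorem IsOrbitMetric.inner_leftVec (hinv : IsInvariantMetric G g) {x : M}
    {gN : SmoothMetric d (G ⧸ H)} (hgN : IsOrbitMetric k g x gN) (a : G)
    (X Y : GroupLieAlgebra (𝓡 k) G) :
    gN.inner (QuotientGroup.mk a) (leftVec k d H a X) (leftVec k d H a Y) = orbitForm g x X Y := by
  refine (hgN a (mulInvariantVectorField X a) (mulInvariantVectorField Y a)).trans ?_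
  rw [mfderiv_orbitMap_mulInvariantVectorField, mfderiv_orbitMap_mulInvariantVectorField]
  exact hinv a x _ _

/-- As `b` fixes `x`, the action field of Ad(b)X at `x` is the image of that of X under the
differential of `b`, an isometry of the tangent space. -/
theorem orbitForm_adjointAction (hinv : IsInvariantMetric G g) {x : M} {b : G} (hb : b • x = x)
    (X Y : GroupLieAlgebra (𝓡 k) G) :
    orbitForm g x (adjointAction b X) (adjointAction b Y) = orbitForm g x X Y := by
  have hb' : b⁻¹ • x = x := inv_smul_eq_iff.2 hb.symm
  have key : ∀ X : GroupLieAlgebra (𝓡 k) G,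
      (actionField (adjointAction b X) x : EuclideanSpace ℝ (Fin m)) =
      mfderiv (𝓡 m) (𝓡 m) (fun y : M => b • y) x (actionField X x) := by
    intro X
    have h1 := mfderiv_comp_apply_of_base_eq (I := 𝓡 k) (I' := 𝓡 k) (I'' := 𝓡 m)
      (f := fun c : G => b * c * b⁻¹) (g := fun c : G => c • x) (x := 1) (y := 1) (by simp)
      (mdifferentiableAt_orbitMap x 1) (mdifferentiableAt_conj b 1) X
    have h2 := mfderiv_comp_apply_of_base_eq (I := 𝓡 k) (I' := 𝓡 m) (I'' := 𝓡 m)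
      (f := fun c : G => c • x) (g := fun y : M => b • y) (x := (1 : G)) (one_smul G x)
      (mdifferentiableAt_const_smul k b x) (mdifferentiableAt_orbitMap x 1) X
    have h3 : (fun c : G => (b * c * b⁻¹) • x) = fun c : G => b • c • x := by
      funext c
      rw [mul_smul, mul_smul, hb']
    rw [h3] at h1
    exact h1.symm.trans h2
  have hpt : ∀ (y : M), y = x → ∀ v w : EuclideanSpace ℝ (Fin m),
      (g.inner y : EuclideanSpace ℝ (Fin m) →L[ℝ] EuclideanSpace ℝ (Fin m) →L[ℝ] ℝ) v w =
      (g.inner x : EuclideanSpace ℝ (Fin m) →L[ℝ] EuclideanSpace ℝ (Fin m) →L[ℝ] ℝ) v w := by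
    rintro y rfl v w
    rfl
  have h := hinv b x (actionField X x) (actionField Y x)
  rw [orbitForm, key, key]
  exact (hpt _ hb _ _).symm.trans h

end LeftDeriv

/-! ### Representing linear forms on a subspace. -/

section LinearAlgebra

variable {V : Type*} [AddCommGroup V] [Module ℝ V]

/-- Two families of vectors in `V` that are dual to each other on `W` with respect to the bilinear
form `A`: they compute the vector of `W` that represents a linear form. -/
structure IsDualFamily (A : V →ₗ[ℝ] V →ₗ[ℝ] ℝ) (W : Submodule ℝ V) {r : ℕ} (e e' : Fin r → V) :
    Prop where
  mem : ∀ j, e' j ∈ W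
  apply_sum : ∀ (l : V →ₗ[ℝ] ℝ), ∀ X ∈ W, A (∑ j, l (e j) • e' j) X = l X

/-- A basis of W and its dual basis for the restricted form. Positivity is asked on W only, since
the form of the singular orbit is definite on 𝔪 but degenerate along 𝔨. -/
theorem exists_isDualFamily [FiniteDimensional ℝ V] (A : V →ₗ[ℝ] V →ₗ[ℝ] ℝ) (W : Submodule ℝ V)
    (hpos : ∀ X ∈ W, X ≠ 0 → 0 < A X X) :
    ∃ e e' : Fin (Module.finrank ℝ W) → V, IsDualFamily A W e e' := by
  let B : LinearMap.BilinForm ℝ W := A.domRestrict₁₂ W W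
  have hB : B.Nondegenerate := by
    have h : ∀ X : W, B X X = 0 → X = 0 := by
      intro X hX
      by_contra h0
      exact (hpos X X.2 (by simpa using h0)).ne' hX
    exact ⟨fun X hX => h X (hX X), fun X hX => h X (hX X)⟩
  let b := Module.finBasis ℝ W
  refine ⟨fun j => b j, fun j => B.dualBasis hB b j, fun j => Subtype.property _, ?_⟩
  intro l X hX
  have h : B (∑ j, l (b j) • B.dualBasis hB b j) = l.domRestrict W := by
    refine b.ext fun i => ?_
    simp [LinearMap.sum_apply, LinearMap.BilinForm.apply_dualBasis_left]
  have h2 := DFunLike.congr_fun h ⟨X, hX⟩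
  simp only [map_sum, map_smul, LinearMap.sum_apply, LinearMap.smul_apply] at h2 ⊢
  exact h2

theorem exists_represent [FiniteDimensional ℝ V] (A : V →ₗ[ℝ] V →ₗ[ℝ] ℝ)
    (hpos : ∀ X, X ≠ 0 → 0 < A X X) (l : V →ₗ[ℝ] ℝ) : ∃ Y, ∀ X, A Y X = l X := by
  obtain ⟨e, e', he⟩ := exists_isDualFamily A ⊤ fun X _ => hpos X
  exact ⟨_, fun X => he.apply_sum l X trivial⟩

theorem IsDualFamily.eq_of_represent {A : V →ₗ[ℝ] V →ₗ[ℝ] ℝ} {W : Submodule ℝ V} {r : ℕ}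
    {e e' : Fin r → V} (he : IsDualFamily A W e e') (hpos : ∀ X ∈ W, X ≠ 0 → 0 < A X X)
    {l : V →ₗ[ℝ] ℝ} {Y : V} (hY : Y ∈ W) (h : ∀ X ∈ W, A Y X = l X) :
    Y = ∑ j, l (e j) • e' j := by
  have hmem : Y - ∑ j, l (e j) • e' j ∈ W :=
    W.sub_mem hY (W.sum_mem fun j _ => W.smul_mem _ (he.mem j))
  by_contra h0
  have := hpos _ hmem (sub_ne_zero.2 h0)
  rw [LinearMap.map_sub₂, h _ hmem, he.apply_sum l _ hmem, sub_self] at this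
  exact lt_irrefl _ this

end LinearAlgebra

/-! ### Gradients and energy in the left invariant frame. -/

section Gradient

variable {n : ℕ} {N : Type*} [TopologicalSpace N]
  [ChartedSpace (EuclideanSpace ℝ (Fin n)) N] [IsManifold (𝓡 n) ∞ N]

/-- `IsLaplacian` asks no regularity of the gradient field, so a pointwise Riesz representation
suffices. -/
theorem exists_isGradient (g : SmoothMetric n N) (φ : N → ℝ) :
    ∃ V : ∀ x : N, TangentSpace (𝓡 n) x, IsGradient g φ V := by
  have h : ∀ x : N, ∃ Y : TangentSpace (𝓡 n) x, ∀ X, g.inner x Y X = differential φ x X := by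
    intro x
    have : FiniteDimensional ℝ (TangentSpace (𝓡 n) x) :=
      inferInstanceAs (FiniteDimensional ℝ (EuclideanSpace ℝ (Fin n)))
    exact exists_represent (metricForm g x) (g.pos x)
      (mfderiv (𝓡 n) 𝓘(ℝ, ℝ) φ x : EuclideanSpace ℝ (Fin n) →L[ℝ] ℝ).toLinearMap
  choose V hV using h
  exact ⟨V, hV⟩

end Gradient

section Energy

variable {k d m r : ℕ} {G : Type*} [Group G] [TopologicalSpace G]
  [ChartedSpace (EuclideanSpace ℝ (Fin k)) G] [LieGroup (𝓡 k) ∞ G]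
  {e e' : Fin r → GroupLieAlgebra (𝓡 k) G}

/-- The element of the Lie algebra that represents the derivative of `w` at `a`. -/
def rieszVec (e e' : Fin r → GroupLieAlgebra (𝓡 k) G) (w : G → ℝ) (a : G) :
    GroupLieAlgebra (𝓡 k) G := ∑ j, leftDeriv w a (e j) • e' j

/-- The inner product of the differentials of the functions `w` and `u` on `G`. -/
def energy (e e' : Fin r → GroupLieAlgebra (𝓡 k) G) (w u : G → ℝ) (a : G) : ℝ :=
  leftDeriv u a (rieszVec e e' w a)

theorem continuous_energy {w u : G → ℝ} (hw : ContMDiff (𝓡 k) 𝓘(ℝ, ℝ) ∞ w)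
    (hu : ContMDiff (𝓡 k) 𝓘(ℝ, ℝ) ∞ u) : Continuous (energy e e' w u) := by
  have : energy e e' w u = fun a => ∑ j, leftDeriv w a (e j) * leftDeriv u a (e' j) := by
    funext a
    simp only [energy, rieszVec, map_sum, map_smul, smul_eq_mul]
  rw [this]
  exact continuous_finsetSum _ fun j _ => (continuous_leftDeriv hw _).mul (continuous_leftDeriv hu _)

variable {M : Type*} [TopologicalSpace M] [ChartedSpace (EuclideanSpace ℝ (Fin m)) M]
  [IsManifold (𝓡 m) ∞ M] [MulAction G M] [ContMDiffSMul (𝓡 k) (𝓡 m) ∞ G M]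

/-- `orbitForm` as a bilinear form. -/
def orbitBilin (k : ℕ) (G : Type*) [Group G] [TopologicalSpace G]
    [ChartedSpace (EuclideanSpace ℝ (Fin k)) G] [MulAction G M] (g : SmoothMetric m M) (x : M) :
    GroupLieAlgebra (𝓡 k) G →ₗ[ℝ] GroupLieAlgebra (𝓡 k) G →ₗ[ℝ] ℝ :=
  let F : EuclideanSpace ℝ (Fin k) →ₗ[ℝ] EuclideanSpace ℝ (Fin m) :=
    (mfderiv (𝓡 k) (𝓡 m) (fun a : G => a • x) (1 : G) :
      EuclideanSpace ℝ (Fin k) →L[ℝ] EuclideanSpace ℝ (Fin m)).toLinearMap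
  (metricForm g x : EuclideanSpace ℝ (Fin m) →ₗ[ℝ] EuclideanSpace ℝ (Fin m) →ₗ[ℝ] ℝ).compl₁₂ F F

theorem orbitBilin_apply (g : SmoothMetric m M) (x : M) (X Y : GroupLieAlgebra (𝓡 k) G) :
    orbitBilin k G g x X Y = orbitForm g x X Y := rfl

theorem orbitForm_comm (g : SmoothMetric m M) (x : M) (X Y : GroupLieAlgebra (𝓡 k) G) :
    orbitForm g x X Y = orbitForm g x Y X := g.symm x _ _

variable {g : SmoothMetric m M} {x : M} {𝔪 𝔭 : Submodule ℝ (GroupLieAlgebra (𝓡 k) G)}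

theorem rieszVec_mem (he : IsDualFamily (orbitBilin k G g x) 𝔪 e e') (w : G → ℝ) (a : G) :
    rieszVec e e' w a ∈ 𝔪 :=
  𝔪.sum_mem fun j _ => 𝔪.smul_mem _ (he.mem j)

theorem orbitForm_rieszVec (he : IsDualFamily (orbitBilin k G g x) 𝔪 e e') (w : G → ℝ) (a : G)
    {X : GroupLieAlgebra (𝓡 k) G} (hX : X ∈ 𝔪) :
    orbitForm g x (rieszVec e e' w a) X = leftDeriv w a X :=
  he.apply_sum (leftDeriv w a) X hX

/-- Both sides are the value of the symmetric orbit form on the two representing vectors, which lie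
in 𝔪. -/
theorem energy_comm (he : IsDualFamily (orbitBilin k G g x) 𝔪 e e') (w u : G → ℝ) :
    energy e e' w u = energy e e' u w := by
  funext a
  rw [energy, energy, ← orbitForm_rieszVec he u a (rieszVec_mem he w a),
    ← orbitForm_rieszVec he w a (rieszVec_mem he u a), orbitForm_comm]

section Orbit

variable {K : Subgroup G} [ChartedSpace (EuclideanSpace ℝ (Fin d)) (G ⧸ K)]
  [IsManifold (𝓡 d) ∞ (G ⧸ K)]

theorem IsOrbitMetric.orbitForm_pos (hinv : IsInvariantMetric G g) {gS : SmoothMetric d (G ⧸ K)}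
    (hgS : IsOrbitMetric k g x gS) (hdisj : Disjoint (subgroupLieAlgebra k d K) 𝔪)
    {X : GroupLieAlgebra (𝓡 k) G} (hX : X ∈ 𝔪) (h0 : X ≠ 0) : 0 < orbitForm g x X X := by
  rw [← hgS.inner_leftVec hinv (1 : G) X X]
  refine gS.pos _ _ fun h => h0 ?_
  exact Submodule.disjoint_def.1 hdisj X ((leftVec_one (d := d) (H := K) X).symm.trans h) hX

theorem exists_mem_leftVec_eq (hGK : IsHomogeneousStructure k d K)
    {W : Submodule ℝ (GroupLieAlgebra (𝓡 k) G)}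
    (hcod : subgroupLieAlgebra k d K ⊔ W = ⊤) (a : G)
    (y : TangentSpace (𝓡 d) (QuotientGroup.mk a : G ⧸ K)) : ∃ Y ∈ W, leftVec k d K a Y = y := by
  obtain ⟨Z, rfl⟩ := leftVec_surjective hGK a y
  have hZ : Z ∈ subgroupLieAlgebra k d K ⊔ W := hcod ▸ Submodule.mem_top
  obtain ⟨U, hU, Y, hY, rfl⟩ := Submodule.mem_sup.1 hZ
  exact ⟨Y, hY, by rw [map_add, leftVec_eq_zero hGK a hU, zero_add]⟩

/-- On the orbit itself `dχ (grad φ)` is the energy. -/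
theorem IsGradient.differential_eq_energy (hinv : IsInvariantMetric G g)
    (hGK : IsHomogeneousStructure k d K) {gS : SmoothMetric d (G ⧸ K)}
    (hgS : IsOrbitMetric k g x gS) (h𝔪 : IsCompl (subgroupLieAlgebra k d K) 𝔪)
    (he : IsDualFamily (orbitBilin k G g x) 𝔪 e e') {φ χ : G ⧸ K → ℝ}
    (hφ : ContMDiff (𝓡 d) 𝓘(ℝ, ℝ) ∞ φ) (hχ : ContMDiff (𝓡 d) 𝓘(ℝ, ℝ) ∞ χ)
    {V : ∀ y : G ⧸ K, TangentSpace (𝓡 d) y} (hV : IsGradient gS φ V) (a : G) :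
    differential χ (QuotientGroup.mk a) (V (QuotientGroup.mk a)) =
      energy e e' (fun c => φ (QuotientGroup.mk c)) (fun c => χ (QuotientGroup.mk c)) a := by
  obtain ⟨Y, hY, hYV⟩ := exists_mem_leftVec_eq hGK h𝔪.sup_eq_top a (V (QuotientGroup.mk a))
  have hYr : Y = rieszVec e e' (fun c => φ (QuotientGroup.mk c)) a := by
    refine he.eq_of_represent (l := leftDeriv _ a)
      (fun X hX h0 => hgS.orbitForm_pos hinv h𝔪.disjoint hX h0) hY fun X hX => ?_
    rw [orbitBilin_apply, ← hgS.inner_leftVec hinv a, hYV, hV, differential_leftVec hGK hφ]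
  rw [← hYV, differential_leftVec hGK hχ, hYr, energy]

end Orbit

section OrbitPair

variable {s : ℕ} {H K : Subgroup G} [ChartedSpace (EuclideanSpace ℝ (Fin d)) (G ⧸ H)]
  [IsManifold (𝓡 d) ∞ (G ⧸ H)] [ChartedSpace (EuclideanSpace ℝ (Fin s)) (G ⧸ K)]
  [IsManifold (𝓡 s) ∞ (G ⧸ K)]

theorem leftDeriv_comp_mk_eq_zero (hGK : IsHomogeneousStructure k s K) {χ : G ⧸ K → ℝ}
    (hχ : ContMDiff (𝓡 s) 𝓘(ℝ, ℝ) ∞ χ) (a : G) {X : GroupLieAlgebra (𝓡 k) G}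
    (hX : X ∈ subgroupLieAlgebra k s K) :
    leftDeriv (fun c : G => χ (QuotientGroup.mk c)) a X = 0 := by
  rw [← differential_leftVec hGK hχ, leftVec_eq_zero hGK a hX]
  exact map_zero (mfderiv (𝓡 s) 𝓘(ℝ, ℝ) χ (QuotientGroup.mk a) : EuclideanSpace ℝ (Fin s) →L[ℝ] ℝ)

theorem exists_leftVec_add_eq (hGH : IsHomogeneousStructure k d H)
    (h𝔪 : IsCompl (subgroupLieAlgebra k s K) 𝔪)
    (h𝔭sup : subgroupLieAlgebra k d H ⊔ 𝔭 = subgroupLieAlgebra k s K) (a : G)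
    (y : TangentSpace (𝓡 d) (QuotientGroup.mk a : G ⧸ H)) :
    ∃ Y ∈ 𝔪, ∃ Z ∈ 𝔭, leftVec k d H a (Y + Z) = y := by
  have hsup : subgroupLieAlgebra k d H ⊔ (𝔪 ⊔ 𝔭) = ⊤ := by
    rw [sup_comm 𝔪, ← sup_assoc, h𝔭sup, h𝔪.sup_eq_top]
  obtain ⟨T, hT, hTy⟩ := exists_mem_leftVec_eq hGH hsup a y
  obtain ⟨Y, hY, Z, hZ, rfl⟩ := Submodule.mem_sup.1 hT
  exact ⟨Y, hY, Z, hZ, hTy⟩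

variable {y : M} {C : ℝ}

/-- Adaptedness enters here. Pairing the gradient Y + Z with X in 𝔪 removes Z and leaves C·A(Y, X),
so CY represents the derivative of φ on 𝔪. -/
theorem smul_eq_rieszVec (hinv : IsInvariantMetric G g)
    (hGH : IsHomogeneousStructure k d H) {gS : SmoothMetric s (G ⧸ K)}
    (hgS : IsOrbitMetric k g x gS) {gt : SmoothMetric d (G ⧸ H)} (hgt : IsOrbitMetric k g y gt)
    (h𝔪 : IsCompl (subgroupLieAlgebra k s K) 𝔪)
    (hC : ∀ X ∈ 𝔪, ∀ X' ∈ 𝔪, ∀ Y ∈ 𝔭, ∀ Y' ∈ 𝔭,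
      orbitForm g y (X + Y) (X' + Y') = C * orbitForm g x X X' + orbitForm g y Y Y')
    (he : IsDualFamily (orbitBilin k G g x) 𝔪 e e') {φ : G ⧸ H → ℝ}
    (hφ : ContMDiff (𝓡 d) 𝓘(ℝ, ℝ) ∞ φ)
    {V : ∀ z : G ⧸ H, TangentSpace (𝓡 d) z} (hV : IsGradient gt φ V) (a : G)
    {Y Z : GroupLieAlgebra (𝓡 k) G} (hY : Y ∈ 𝔪) (hZ : Z ∈ 𝔭)
    (hYZ : leftVec k d H a (Y + Z) = V (QuotientGroup.mk a)) :
    C • Y = rieszVec e e' (fun c => φ (QuotientGroup.mk c)) a := by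
  refine he.eq_of_represent (l := leftDeriv _ a)
      (fun X hX h0 => hgS.orbitForm_pos hinv h𝔪.disjoint hX h0) (𝔪.smul_mem _ hY) fun X hX => ?_
  have h1 := hC Y hY X hX Z hZ 0 𝔭.zero_mem
  have h2 : orbitForm g y Z (0 : GroupLieAlgebra (𝓡 k) G) = 0 := map_zero (orbitBilin k G g y Z)
  rw [add_zero, h2, add_zero, ← hgt.inner_leftVec hinv a, hYZ, hV, differential_leftVec hGH hφ]
    at h1
  rw [map_smul, LinearMap.smul_apply, smul_eq_mul, orbitBilin_apply]
  exact h1.symm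

/-- For a function `φ` on the principal orbit and the lift of a function `χ` on the singular
orbit, `dχ (grad φ)` is a multiple of the energy. -/
theorem IsGradient.differential_comp_eq_energy (hHK : H ≤ K) (hinv : IsInvariantMetric G g)
    (hGH : IsHomogeneousStructure k d H) (hGK : IsHomogeneousStructure k s K)
    {gS : SmoothMetric s (G ⧸ K)}
    (hgS : IsOrbitMetric k g x gS) {gt : SmoothMetric d (G ⧸ H)} (hgt : IsOrbitMetric k g y gt)
    (h𝔪 : IsCompl (subgroupLieAlgebra k s K) 𝔪)
    (h𝔭sup : subgroupLieAlgebra k d H ⊔ 𝔭 = subgroupLieAlgebra k s K) (hC0 : C ≠ 0)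
    (hC : ∀ X ∈ 𝔪, ∀ X' ∈ 𝔪, ∀ Y ∈ 𝔭, ∀ Y' ∈ 𝔭,
      orbitForm g y (X + Y) (X' + Y') = C * orbitForm g x X X' + orbitForm g y Y Y')
    (he : IsDualFamily (orbitBilin k G g x) 𝔪 e e') {φ : G ⧸ H → ℝ} {χ : G ⧸ K → ℝ}
    (hφ : ContMDiff (𝓡 d) 𝓘(ℝ, ℝ) ∞ φ) (hχ : ContMDiff (𝓡 s) 𝓘(ℝ, ℝ) ∞ χ)
    {V : ∀ z : G ⧸ H, TangentSpace (𝓡 d) z} (hV : IsGradient gt φ V) (a : G) :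
    differential (χ ∘ Subgroup.quotientMapOfLE hHK) (QuotientGroup.mk a)
        (V (QuotientGroup.mk a)) =
      C⁻¹ * energy e e' (fun c => φ (QuotientGroup.mk c)) (fun c => χ (QuotientGroup.mk c)) a := by
  obtain ⟨Y, hY, Z, hZ, hYZ⟩ := exists_leftVec_add_eq hGH h𝔪 h𝔭sup a (V (QuotientGroup.mk a))
  have hYr := smul_eq_rieszVec hinv hGH hgS hgt h𝔪 hC he hφ hV a hY hZ hYZ
  -- The 𝔭-part of the gradient may be nonzero, but it lies in 𝔨, along which the lift of χ has
  -- derivative zero.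
  have hZK : Z ∈ subgroupLieAlgebra k s K := h𝔭sup ▸ Submodule.mem_sup_right hZ
  have hχq : ContMDiff (𝓡 d) 𝓘(ℝ, ℝ) ∞ (χ ∘ Subgroup.quotientMapOfLE hHK) :=
    hGH.contMDiff_of_comp_mk (hχ.comp hGK.1)
  rw [energy, ← hYr, map_smul, smul_eq_mul, inv_mul_cancel_left₀ hC0, ← hYZ,
    differential_leftVec hGH hχq]
  change leftDeriv (fun c : G => χ (QuotientGroup.mk c)) a (Y + Z) = _
  rw [map_add, leftDeriv_comp_mk_eq_zero hGK hχ a hZK, add_zero]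

/-- For the lift of a function `φ` on the singular orbit and a function `χ` on the principal
orbit, `dχ (grad φ)` is a multiple of the energy. -/
theorem IsGradient.differential_eq_energy_of_comp (hHK : H ≤ K) (hinv : IsInvariantMetric G g)
    (hGH : IsHomogeneousStructure k d H) (hGK : IsHomogeneousStructure k s K)
    {gS : SmoothMetric s (G ⧸ K)}
    (hgS : IsOrbitMetric k g x gS) {gt : SmoothMetric d (G ⧸ H)} (hgt : IsOrbitMetric k g y gt)
    (h𝔪 : IsCompl (subgroupLieAlgebra k s K) 𝔪)
    (h𝔭sup : subgroupLieAlgebra k d H ⊔ 𝔭 = subgroupLieAlgebra k s K) (hC0 : C ≠ 0)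
    (hC : ∀ X ∈ 𝔪, ∀ X' ∈ 𝔪, ∀ Y ∈ 𝔭, ∀ Y' ∈ 𝔭,
      orbitForm g y (X + Y) (X' + Y') = C * orbitForm g x X X' + orbitForm g y Y Y')
    (he : IsDualFamily (orbitBilin k G g x) 𝔪 e e') {φ : G ⧸ K → ℝ} {χ : G ⧸ H → ℝ}
    (hφ : ContMDiff (𝓡 s) 𝓘(ℝ, ℝ) ∞ φ) (hχ : ContMDiff (𝓡 d) 𝓘(ℝ, ℝ) ∞ χ)
    {V : ∀ z : G ⧸ H, TangentSpace (𝓡 d) z}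
    (hV : IsGradient gt (φ ∘ Subgroup.quotientMapOfLE hHK) V) (a : G) :
    differential χ (QuotientGroup.mk a) (V (QuotientGroup.mk a)) =
      C⁻¹ * energy e e' (fun c => φ (QuotientGroup.mk c)) (fun c => χ (QuotientGroup.mk c)) a := by
  obtain ⟨Y, hY, Z, hZ, hYZ⟩ := exists_leftVec_add_eq hGH h𝔪 h𝔭sup a (V (QuotientGroup.mk a))
  have hφq : ContMDiff (𝓡 d) 𝓘(ℝ, ℝ) ∞ (φ ∘ Subgroup.quotientMapOfLE hHK) :=
    hGH.contMDiff_of_comp_mk (hφ.comp hGK.1)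
  have hYr := smul_eq_rieszVec hinv hGH hgS hgt h𝔪 hC he hφq hV a hY hZ hYZ
  have hZK : Z ∈ subgroupLieAlgebra k s K := h𝔭sup ▸ Submodule.mem_sup_right hZ
  -- The gradient of a lift has no vertical part: the square length of Z is its pairing with the
  -- whole gradient, that is, the derivative of the lift along Z, which is zero.
  have hZ0 : leftVec k d H a Z = 0 := by
    by_contra h0
    have h1 := gt.pos _ _ h0
    rw [hgt.inner_leftVec hinv] at h1
    have h2 := hC Y hY 0 𝔪.zero_mem Z hZ Z hZ
    have h3 : orbitForm g x Y (0 : GroupLieAlgebra (𝓡 k) G) = 0 := map_zero (orbitBilin k G g x Y)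
    rw [h3, mul_zero, zero_add, zero_add, ← hgt.inner_leftVec hinv a, hYZ, hV,
      differential_leftVec hGH hφq] at h2
    have h4 : leftDeriv (fun c : G => φ (QuotientGroup.mk c)) a Z = 0 :=
      leftDeriv_comp_mk_eq_zero hGK hφ a hZK
    exact h1.ne (h4.symm.trans h2)
  rw [map_add, hZ0, add_zero] at hYZ
  change _ = C⁻¹ * leftDeriv (fun c => χ (QuotientGroup.mk c)) a (rieszVec e e'
    (fun c => (φ ∘ Subgroup.quotientMapOfLE hHK) (QuotientGroup.mk c)) a)
  rw [← hYr, map_smul, smul_eq_mul, inv_mul_cancel_left₀ hC0, ← hYZ,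
    differential_leftVec hGH hχ]

end OrbitPair

end Energy

/-! ### Independence of the normalization of the volume. -/

section SmulVolume

variable {n : ℕ} {N : Type*} [TopologicalSpace N]
  [ChartedSpace (EuclideanSpace ℝ (Fin n)) N] [IsManifold (𝓡 n) ∞ N] [MeasurableSpace N]
  {g : SmoothMetric n N} {ν : Measure N} {c : ℝ≥0∞}

/-- The Laplacian may be computed with any multiple of the Riemannian volume. -/
theorem isLaplacian_iff_of_volume_eq_smul (hc0 : c ≠ 0) (hc : c ≠ ⊤)
    (hν : riemannianVolume g = c • ν) {φ h : N → ℝ} :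
    IsLaplacian g φ h ↔ ContMDiff (𝓡 n) 𝓘(ℝ, ℝ) ∞ φ ∧ ContMDiff (𝓡 n) 𝓘(ℝ, ℝ) ∞ h ∧
      ∃ V : ∀ x : N, TangentSpace (𝓡 n) x, IsGradient g φ V ∧
        ∀ χ : N → ℝ, ContMDiff (𝓡 n) 𝓘(ℝ, ℝ) ∞ χ →
          ∫ x, h x * χ x ∂ν = ∫ x, differential χ x (V x) ∂ν := by
  have h0 : c.toReal ≠ 0 := (ENNReal.toReal_pos hc0 hc).ne'
  simp only [IsLaplacian, hν, integral_smul_measure, smul_eq_mul, mul_right_inj' h0]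

theorem isLaplaceEigenfunction_iff_of_volume_eq_smul (hc0 : c ≠ 0) (hc : c ≠ ⊤)
    (hν : riemannianVolume g = c • ν) {f : N → ℝ} :
    IsLaplaceEigenfunction g f ↔ MemLp f 2 ν ∧ ¬ f =ᵐ[ν] 0 ∧
      ∃ lam : ℝ, ∀ φ h : N → ℝ, IsLaplacian g φ h →
        ∫ x, f x * h x ∂ν = ∫ x, lam * f x * φ x ∂ν := by
  have h0 : c.toReal ≠ 0 := (ENNReal.toReal_pos hc0 hc).ne'
  have h1 : MemLp f 2 (c • ν) ↔ MemLp f 2 ν := by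
    refine ⟨fun h => ?_, fun h => h.smul_measure hc⟩
    have := h.smul_measure (ENNReal.inv_ne_top.2 hc0)
    rwa [smul_smul, ENNReal.inv_mul_cancel hc0 hc, one_smul] at this
  simp only [IsLaplaceEigenfunction, hν, integral_smul_measure, smul_eq_mul, mul_right_inj' h0, h1,
    Measure.ae_ennreal_smul_measure_eq hc0]

end SmulVolume

/-! ### Averaging the energy over K. -/

section Average

variable {k m r : ℕ} {G : Type*} [Group G] [TopologicalSpace G] [IsTopologicalGroup G]
  [CompactSpace G] [SecondCountableTopology G] [MeasurableSpace G] [BorelSpace G]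
  [ChartedSpace (EuclideanSpace ℝ (Fin k)) G] [LieGroup (𝓡 k) ∞ G]
  {e e' : Fin r → GroupLieAlgebra (𝓡 k) G}
  {M : Type*} [TopologicalSpace M] [ChartedSpace (EuclideanSpace ℝ (Fin m)) M]
  [IsManifold (𝓡 m) ∞ M] [MulAction G M] [ContMDiffSMul (𝓡 k) (𝓡 m) ∞ G M]
  {g : SmoothMetric m M} {x : M} {𝔪 : Submodule ℝ (GroupLieAlgebra (𝓡 k) G)}
  {K : Subgroup G}

/-- For right K-invariant `w` the derivative at `a * b` along X is the one at `a` along Ad(b)X. As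
Ad(b) preserves 𝔪 and the form, the representing vectors correspond under its inverse. -/
theorem rieszVec_mul (hinv : IsInvariantMetric G g) (hK : ∀ b ∈ K, b • x = x)
    (h𝔪inv : IsAdInvariant K 𝔪) (hpos : ∀ X ∈ 𝔪, X ≠ 0 → 0 < orbitForm g x X X)
    (he : IsDualFamily (orbitBilin k G g x) 𝔪 e e') {w : G → ℝ}
    (hw : ContMDiff (𝓡 k) 𝓘(ℝ, ℝ) ∞ w) (hwK : ∀ (a : G) (b : K), w (a * b) = w a) (a : G) (b : K) :
    rieszVec e e' w (a * b) = adjointAction (b : G)⁻¹ (rieszVec e e' w a) := by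
  symm
  refine he.eq_of_represent (l := leftDeriv w (a * b)) hpos
    (h𝔪inv _ (K.inv_mem b.2) _ (rieszVec_mem he w a)) fun X hX => ?_
  have hX' : adjointAction (b : G) X ∈ 𝔪 := h𝔪inv _ b.2 X hX
  have hXX : X = adjointAction (b : G)⁻¹ (adjointAction (b : G) X) := by
    rw [← adjointAction_mul, inv_mul_cancel, adjointAction_one]
  rw [orbitBilin_apply, hXX, orbitForm_adjointAction hinv (hK _ (K.inv_mem b.2)),
    orbitForm_rieszVec he w a hX', ← leftDeriv_comp_mul_right hw]
  simp only [hwK]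

variable [hKc : IsClosed (K : Set G)] (κ : Measure K) [IsProbabilityMeasure κ]

/-- Moving from `a` to `a * b` twists the representing vector of `w` and the derivative of `u` by
matching adjoint actions. So the direction of differentiation stays fixed while `b` varies, and the
derivative comes out of the average. -/
theorem rightAverage_energy (hinv : IsInvariantMetric G g) (hK : ∀ b ∈ K, b • x = x)
    (h𝔪inv : IsAdInvariant K 𝔪) (hpos : ∀ X ∈ 𝔪, X ≠ 0 → 0 < orbitForm g x X X)
    (he : IsDualFamily (orbitBilin k G g x) 𝔪 e e') {w u : G → ℝ}
    (hw : ContMDiff (𝓡 k) 𝓘(ℝ, ℝ) ∞ w) (hwK : ∀ (a : G) (b : K), w (a * b) = w a)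
    (hu : ContMDiff (𝓡 k) 𝓘(ℝ, ℝ) ∞ u) :
    rightAverage κ (energy e e' w u) = energy e e' w (rightAverage κ u) := by
  funext a
  rw [energy, leftDeriv_apply, differential_rightAverage κ hu]
  refine integral_congr_ae (ae_of_all _ fun b => ?_)
  change leftDeriv u (a * b) (rieszVec e e' w (a * b)) =
    leftDeriv (fun c : G => u (c * b)) a (rieszVec e e' w a)
  rw [rieszVec_mul hinv hK h𝔪inv hpos he hw hwK, leftDeriv_comp_mul_right hu]

variable (μ : Measure G) [IsProbabilityMeasure μ] [μ.IsMulRightInvariant]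

theorem integral_energy_rightAverage (hinv : IsInvariantMetric G g) (hK : ∀ b ∈ K, b • x = x)
    (h𝔪inv : IsAdInvariant K 𝔪) (hpos : ∀ X ∈ 𝔪, X ≠ 0 → 0 < orbitForm g x X X)
    (he : IsDualFamily (orbitBilin k G g x) 𝔪 e e') {w u : G → ℝ}
    (hw : ContMDiff (𝓡 k) 𝓘(ℝ, ℝ) ∞ w) (hwK : ∀ (a : G) (b : K), w (a * b) = w a)
    (hu : ContMDiff (𝓡 k) 𝓘(ℝ, ℝ) ∞ u) :
    ∫ a, energy e e' w (rightAverage κ u) a ∂μ = ∫ a, energy e e' w u a ∂μ := by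
  rw [← rightAverage_energy κ hinv hK h𝔪inv hpos he hw hwK hu]
  have h := integral_mul_rightAverage μ κ (u := fun _ => 1) (w := energy e e' w u)
    (fun _ _ => rfl) (by
      simpa using (continuous_energy hw hu).integrable_of_hasCompactSupport
        (HasCompactSupport.of_compactSpace _))
  simpa using h

end Average

/-! ### Lifting functions along q and integrating over its fibres. -/

section Quotient

variable {k d s : ℕ} {G : Type*} [Group G] [TopologicalSpace G] [IsTopologicalGroup G]
  [CompactSpace G] [SecondCountableTopology G] [MeasurableSpace G] [BorelSpace G]
  [ChartedSpace (EuclideanSpace ℝ (Fin k)) G] [LieGroup (𝓡 k) ∞ G]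
  {H K : Subgroup G}
  [ChartedSpace (EuclideanSpace ℝ (Fin d)) (G ⧸ H)] [IsManifold (𝓡 d) ∞ (G ⧸ H)]
  [MeasurableSpace (G ⧸ H)] [BorelSpace (G ⧸ H)]
  [ChartedSpace (EuclideanSpace ℝ (Fin s)) (G ⧸ K)] [IsManifold (𝓡 s) ∞ (G ⧸ K)]
  [MeasurableSpace (G ⧸ K)] [BorelSpace (G ⧸ K)]
  (μ : Measure G) [IsProbabilityMeasure μ] [μ.IsMulRightInvariant]
  (κ : Measure K) [IsProbabilityMeasure κ] [κ.IsMulLeftInvariant]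

theorem measurable_mk (H : Subgroup G) [MeasurableSpace (G ⧸ H)] [BorelSpace (G ⧸ H)] :
    Measurable (QuotientGroup.mk : G → G ⧸ H) :=
  QuotientGroup.continuous_mk.measurable

theorem continuous_of_comp_mk {F : G ⧸ H → ℝ} (hF : Continuous fun a : G => F (QuotientGroup.mk a)) :
    Continuous F :=
  (QuotientGroup.isQuotientMap_mk H).continuous_iff.2 hF

theorem integral_map_mk_of_comp_eq {F : G ⧸ H → ℝ} {w : G → ℝ} (hw : Continuous w)
    (h : ∀ a : G, F (QuotientGroup.mk a) = w a) :
    ∫ y, F y ∂(μ.map (QuotientGroup.mk : G → G ⧸ H)) = ∫ a, w a ∂μ := by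
  have hF : Continuous F := continuous_of_comp_mk (by simpa only [h] using hw)
  rw [integral_map (measurable_mk H).aemeasurable hF.aestronglyMeasurable]
  simp only [h]

theorem measurePreserving_quotientMapOfLE (hHK : H ≤ K) :
    MeasurePreserving (Subgroup.quotientMapOfLE hHK)
      (μ.map (QuotientGroup.mk : G → G ⧸ H)) (μ.map (QuotientGroup.mk : G → G ⧸ K)) := by
  have hq : Continuous (Subgroup.quotientMapOfLE hHK) :=
    (QuotientGroup.isQuotientMap_mk H).continuous_iff.2 QuotientGroup.continuous_mk
  refine ⟨hq.measurable, ?_⟩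
  rw [Measure.map_map hq.measurable (measurable_mk H)]
  rfl

/-- Fibre integration: the average over `K` of a smooth function on `G` descends to `G ⧸ K`. -/
theorem exists_contMDiff_rightAverage [hKc : IsClosed (K : Set G)]
    (hGK : IsHomogeneousStructure k s K) {w : G → ℝ} (hw : ContMDiff (𝓡 k) 𝓘(ℝ, ℝ) ∞ w) :
    ∃ φ : G ⧸ K → ℝ, ContMDiff (𝓡 s) 𝓘(ℝ, ℝ) ∞ φ ∧
      ∀ a : G, φ (QuotientGroup.mk a) = rightAverage κ w a := by
  have hdesc : ∀ a : G, rightAverage κ w (QuotientGroup.mk a : G ⧸ K).out =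
      rightAverage κ w a := by
    intro a
    have h := rightAverage_mul κ w a ⟨a⁻¹ * (QuotientGroup.mk a : G ⧸ K).out,
      QuotientGroup.eq.1 (QuotientGroup.out_eq' _).symm⟩
    simpa using h
  refine ⟨fun y => rightAverage κ w y.out, hGK.contMDiff_of_comp_mk ?_, hdesc⟩
  simp only [hdesc]
  exact contMDiff_rightAverage κ hw

/-- The adjointness of pull back and fibre integration. -/
theorem integral_comp_mul_eq (hHK : H ≤ K) {ψ : G ⧸ K → ℝ} {w : G ⧸ H → ℝ} {w' : G ⧸ K → ℝ}
    (hψ : Integrable ψ (μ.map (QuotientGroup.mk : G → G ⧸ K))) (hw : Continuous w)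
    (hw' : Continuous w')
    (hww' : ∀ a : G, w' (QuotientGroup.mk a) =
      rightAverage κ (fun c : G => w (QuotientGroup.mk c)) a) :
    ∫ y, ψ (Subgroup.quotientMapOfLE hHK y) * w y ∂(μ.map (QuotientGroup.mk : G → G ⧸ H)) =
      ∫ y, ψ y * w' y ∂(μ.map (QuotientGroup.mk : G → G ⧸ K)) := by
  have hψq := (measurePreserving_quotientMapOfLE μ hHK).integrable_comp_of_integrable hψ
  have h1 : AEStronglyMeasurable (fun y => ψ (Subgroup.quotientMapOfLE hHK y) * w y)
      (μ.map (QuotientGroup.mk : G → G ⧸ H)) :=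
    hψq.aestronglyMeasurable.mul hw.aestronglyMeasurable
  have h2 : AEStronglyMeasurable (fun y => ψ y * w' y) (μ.map (QuotientGroup.mk : G → G ⧸ K)) :=
    hψ.aestronglyMeasurable.mul hw'.aestronglyMeasurable
  rw [integral_map (measurable_mk H).aemeasurable h1,
    integral_map (measurable_mk K).aemeasurable h2]
  simp only [hww']
  have hψG : Integrable (fun a : G => ψ (QuotientGroup.mk a)) μ :=
    hψ.comp_measurable (measurable_mk K)
  have hwc : Continuous fun a : G => w (QuotientGroup.mk a) := hw.comp QuotientGroup.continuous_mk
  obtain ⟨C, hC⟩ := isCompact_univ.bddAbove_image hwc.norm.continuousOn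
  have hprod : Integrable (fun a : G => ψ (QuotientGroup.mk a) * w (QuotientGroup.mk a)) μ :=
    hψG.mul_bdd (c := C) hwc.aestronglyMeasurable
      (ae_of_all _ fun a => hC (mem_image_of_mem _ (mem_univ a)))
  exact (integral_mul_rightAverage μ κ (u := fun a : G => ψ (QuotientGroup.mk a))
    (fun a b => congrArg ψ (QuotientGroup.mk_mul_of_mem a b.2)) hprod).symm

end Quotient

/-! ### Transfer of Laplacians and eigenfunctions along q. -/

section Transfer

variable {k m d s : ℕ} {G : Type*} [Group G] [TopologicalSpace G] [IsTopologicalGroup G] [T2Space G]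
  [CompactSpace G] [SecondCountableTopology G] [MeasurableSpace G] [BorelSpace G]
  [ChartedSpace (EuclideanSpace ℝ (Fin k)) G] [LieGroup (𝓡 k) ∞ G]
  {M : Type*} [TopologicalSpace M] [ChartedSpace (EuclideanSpace ℝ (Fin m)) M]
  [IsManifold (𝓡 m) ∞ M] [MulAction G M] [ContMDiffSMul (𝓡 k) (𝓡 m) ∞ G M]
  {g : SmoothMetric m M} {x y : M} {𝔪 𝔭 : Submodule ℝ (GroupLieAlgebra (𝓡 k) G)}
  {H K : Subgroup G}
  [ChartedSpace (EuclideanSpace ℝ (Fin d)) (G ⧸ H)] [IsManifold (𝓡 d) ∞ (G ⧸ H)]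
  [MeasurableSpace (G ⧸ H)] [BorelSpace (G ⧸ H)]
  [ChartedSpace (EuclideanSpace ℝ (Fin s)) (G ⧸ K)] [IsManifold (𝓡 s) ∞ (G ⧸ K)]
  [MeasurableSpace (G ⧸ K)] [BorelSpace (G ⧸ K)]
  {gS : SmoothMetric s (G ⧸ K)} {gt : SmoothMetric d (G ⧸ H)} {C : ℝ} {hHK : H ≤ K}

/-- The lift of a smooth function on `G ⧸ K` and of its Laplacian. -/
theorem IsLaplacian.comp_quotientMapOfLE [hKc : IsClosed (K : Set G)]
    (μ : Measure G) [IsProbabilityMeasure μ] [μ.IsMulRightInvariant]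
    (κ : Measure K) [IsProbabilityMeasure κ] [κ.IsMulLeftInvariant]
    (hinv : IsInvariantMetric G g)
    (hGH : IsHomogeneousStructure k d H) (hGK : IsHomogeneousStructure k s K)
    (hgS : IsOrbitMetric k g x gS) (hgt : IsOrbitMetric k g y gt)
    (hK : ∀ b ∈ K, b • x = x) (h𝔪 : IsCompl (subgroupLieAlgebra k s K) 𝔪)
    (h𝔪inv : IsAdInvariant K 𝔪)
    (h𝔭sup : subgroupLieAlgebra k d H ⊔ 𝔭 = subgroupLieAlgebra k s K) (hC0 : C ≠ 0)
    (hC : ∀ X ∈ 𝔪, ∀ X' ∈ 𝔪, ∀ Y ∈ 𝔭, ∀ Y' ∈ 𝔭,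
      orbitForm g y (X + Y) (X' + Y') = C * orbitForm g x X X' + orbitForm g y Y Y')
    {φ h : G ⧸ K → ℝ} (hφh : IsLaplacian gS φ h) :
    IsLaplacian gt (φ ∘ Subgroup.quotientMapOfLE hHK)
      (fun z => C⁻¹ * h (Subgroup.quotientMapOfLE hHK z)) := by
  have hpos : ∀ X ∈ 𝔪, X ≠ 0 → 0 < orbitForm g x X X :=
    fun X hX h0 => hgS.orbitForm_pos hinv h𝔪.disjoint hX h0
  have : FiniteDimensional ℝ (GroupLieAlgebra (𝓡 k) G) :=
    inferInstanceAs (FiniteDimensional ℝ (EuclideanSpace ℝ (Fin k)))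
  obtain ⟨e, e', he⟩ := exists_isDualFamily (orbitBilin k G g x) 𝔪 hpos
  obtain ⟨c, hc0, hc, hν⟩ := hgS.exists_riemannianVolume_eq hinv hGK μ
  obtain ⟨c', hc0', hc', hν'⟩ := hgt.exists_riemannianVolume_eq hinv hGH μ
  rw [isLaplacian_iff_of_volume_eq_smul hc0 hc hν] at hφh
  rw [isLaplacian_iff_of_volume_eq_smul hc0' hc' hν']
  obtain ⟨hφ, hh, V, hV, hVχ⟩ := hφh
  obtain ⟨W, hW⟩ := exists_isGradient gt (φ ∘ Subgroup.quotientMapOfLE hHK)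
  refine ⟨hGH.contMDiff_of_comp_mk (hφ.comp hGK.1),
    hGH.contMDiff_of_comp_mk (contMDiff_const.mul (hh.comp hGK.1)), W, hW, fun χ hχ => ?_⟩
  have hφG := hφ.comp hGK.1
  have hχG := hχ.comp hGH.1
  -- Replacing the test function χ by its fibre average changes neither its integral against the
  -- lift of `h` nor its integrated energy against φ; the average is a legitimate test function on G
  -- ⧸ K.
  obtain ⟨χ', hχ', hχχ'⟩ := exists_contMDiff_rightAverage κ hGK hχG
  have hint : Integrable h (μ.map (QuotientGroup.mk : G → G ⧸ K)) := by
    have : IsProbabilityMeasure (μ.map (QuotientGroup.mk : G → G ⧸ K)) :=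
      Measure.isProbabilityMeasure_map (measurable_mk K).aemeasurable
    exact hh.continuous.integrable_of_hasCompactSupport (HasCompactSupport.of_compactSpace _)
  simp only [mul_assoc]
  rw [integral_const_mul, integral_comp_mul_eq μ κ hHK hint hχ.continuous hχ'.continuous hχχ',
    hVχ χ' hχ', integral_map_mk_of_comp_eq μ
      (continuous_energy (e := e) (e' := e') hφG (hχ'.comp hGK.1))
      (IsGradient.differential_eq_energy hinv hGK hgS h𝔪 he hφ hχ' hV),
    integral_map_mk_of_comp_eq μ
      ((continuous_energy (e := e) (e' := e') hφG hχG).const_mul C⁻¹)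
      (IsGradient.differential_eq_energy_of_comp hHK hinv hGH hGK hgS hgt h𝔪 h𝔭sup hC0 hC he
        hφ hχ hW), integral_const_mul,
    ← integral_energy_rightAverage κ μ hinv hK h𝔪inv hpos he hφG
      (fun a b => congrArg φ (QuotientGroup.mk_mul_of_mem a b.2)) hχG]
  congr 3
  exact funext fun a => congrArg (fun u => energy e e' _ u a) (funext hχχ')

/-- Fibre integration of a smooth function on `G ⧸ H` and of its Laplacian. -/
theorem IsLaplacian.fiberAverage [hKc : IsClosed (K : Set G)]
    (μ : Measure G) [IsProbabilityMeasure μ] [μ.IsMulRightInvariant]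
    (κ : Measure K) [IsProbabilityMeasure κ] [κ.IsMulLeftInvariant]
    (hHK : H ≤ K) (hinv : IsInvariantMetric G g)
    (hGH : IsHomogeneousStructure k d H) (hGK : IsHomogeneousStructure k s K)
    (hgS : IsOrbitMetric k g x gS) (hgt : IsOrbitMetric k g y gt)
    (hK : ∀ b ∈ K, b • x = x) (h𝔪 : IsCompl (subgroupLieAlgebra k s K) 𝔪)
    (h𝔪inv : IsAdInvariant K 𝔪)
    (h𝔭sup : subgroupLieAlgebra k d H ⊔ 𝔭 = subgroupLieAlgebra k s K) (hC0 : C ≠ 0)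
    (hC : ∀ X ∈ 𝔪, ∀ X' ∈ 𝔪, ∀ Y ∈ 𝔭, ∀ Y' ∈ 𝔭,
      orbitForm g y (X + Y) (X' + Y') = C * orbitForm g x X X' + orbitForm g y Y Y')
    {φ h : G ⧸ H → ℝ} (hφh : IsLaplacian gt φ h) {φ' h' : G ⧸ K → ℝ}
    (hφ' : ContMDiff (𝓡 s) 𝓘(ℝ, ℝ) ∞ φ') (hh' : ContMDiff (𝓡 s) 𝓘(ℝ, ℝ) ∞ h')
    (hφφ' : ∀ a : G, φ' (QuotientGroup.mk a) =
      rightAverage κ (fun c : G => φ (QuotientGroup.mk c)) a)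
    (hhh' : ∀ a : G, h' (QuotientGroup.mk a) =
      rightAverage κ (fun c : G => h (QuotientGroup.mk c)) a) :
    IsLaplacian gS φ' (fun z => C * h' z) := by
  have hpos : ∀ X ∈ 𝔪, X ≠ 0 → 0 < orbitForm g x X X :=
    fun X hX h0 => hgS.orbitForm_pos hinv h𝔪.disjoint hX h0
  have : FiniteDimensional ℝ (GroupLieAlgebra (𝓡 k) G) :=
    inferInstanceAs (FiniteDimensional ℝ (EuclideanSpace ℝ (Fin k)))
  obtain ⟨e, e', he⟩ := exists_isDualFamily (orbitBilin k G g x) 𝔪 hpos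
  obtain ⟨c, hc0, hc, hν⟩ := hgS.exists_riemannianVolume_eq hinv hGK μ
  obtain ⟨c', hc0', hc', hν'⟩ := hgt.exists_riemannianVolume_eq hinv hGH μ
  rw [isLaplacian_iff_of_volume_eq_smul hc0' hc' hν'] at hφh
  rw [isLaplacian_iff_of_volume_eq_smul hc0 hc hν]
  obtain ⟨hφ, hh, W, hW, hWχ⟩ := hφh
  obtain ⟨V, hV⟩ := exists_isGradient gS φ'
  refine ⟨hφ', contMDiff_const.mul hh', V, hV, fun χ hχ => ?_⟩
  have hφG := hφ.comp hGH.1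
  have hφG' := hφ'.comp hGK.1
  have hχG := hχ.comp hGK.1
  have hint : Integrable χ (μ.map (QuotientGroup.mk : G → G ⧸ K)) := by
    have : IsProbabilityMeasure (μ.map (QuotientGroup.mk : G → G ⧸ K)) :=
      Measure.isProbabilityMeasure_map (measurable_mk K).aemeasurable
    exact hχ.continuous.integrable_of_hasCompactSupport (HasCompactSupport.of_compactSpace _)
  have h1 := integral_comp_mul_eq μ κ hHK hint hh.continuous hh'.continuous hhh'
  have h2 := hWχ (χ ∘ Subgroup.quotientMapOfLE hHK)
    (hGH.contMDiff_of_comp_mk (hχ.comp hGK.1))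
  rw [integral_map_mk_of_comp_eq μ
      (F := fun z => differential (χ ∘ Subgroup.quotientMapOfLE hHK) z (W z))
      ((continuous_energy (e := e) (e' := e') hφG hχG).const_mul C⁻¹)
      (IsGradient.differential_comp_eq_energy hHK hinv hGH hGK hgS hgt h𝔪 h𝔭sup hC0 hC he
        hφ hχ hW), integral_const_mul] at h2
  rw [integral_map_mk_of_comp_eq μ (F := fun z => differential χ z (V z))
      (continuous_energy (e := e) (e' := e') hφG' hχG)
      (IsGradient.differential_eq_energy hinv hGK hgS h𝔪 he hφ' hχ hV)]
  -- Averaging passes through the energy when the other argument is right K-invariant. Here that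
  -- argument is χ, so symmetry of the energy is used to put it first.
  have h3 := integral_energy_rightAverage κ μ hinv hK h𝔪inv hpos he hχG
      (fun a b => congrArg χ (QuotientGroup.mk_mul_of_mem a b.2)) hφG
  rw [energy_comm he, energy_comm he _ ((φ : G ⧸ H → ℝ) ∘ QuotientGroup.mk)] at h3
  have h4 : φ' ∘ (QuotientGroup.mk : G → G ⧸ K) =
    rightAverage κ (φ ∘ QuotientGroup.mk) := funext hφφ'
  simp only [mul_assoc, integral_const_mul]
  calc C * ∫ z, h' z * χ z ∂(μ.map (QuotientGroup.mk : G → G ⧸ K))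
      = C * ∫ z, h z * (χ ∘ Subgroup.quotientMapOfLE hHK) z
          ∂(μ.map (QuotientGroup.mk : G → G ⧸ H)) := by
        simp only [mul_comm (h' _), mul_comm (h _), ← h1, Function.comp]
    _ = ∫ a, energy e e' (φ ∘ QuotientGroup.mk) (χ ∘ QuotientGroup.mk) a ∂μ := by
        rw [h2, mul_inv_cancel_left₀ hC0]
    _ = _ := by rw [← h3, h4]

/-- The lift of `ψ` is an eigenfunction on `G ⧸ H` if and only if `ψ` is one on `G ⧸ K`. -/
theorem isLaplaceEigenfunction_comp_quotientMapOfLE_iff [hKc : IsClosed (K : Set G)]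
    (μ : Measure G) [IsProbabilityMeasure μ] [μ.IsMulRightInvariant]
    (κ : Measure K) [IsProbabilityMeasure κ] [κ.IsMulLeftInvariant]
    (hHK : H ≤ K) (hinv : IsInvariantMetric G g)
    (hGH : IsHomogeneousStructure k d H) (hGK : IsHomogeneousStructure k s K)
    (hgS : IsOrbitMetric k g x gS) (hgt : IsOrbitMetric k g y gt)
    (hK : ∀ b ∈ K, b • x = x) (h𝔪 : IsCompl (subgroupLieAlgebra k s K) 𝔪)
    (h𝔪inv : IsAdInvariant K 𝔪)
    (h𝔭sup : subgroupLieAlgebra k d H ⊔ 𝔭 = subgroupLieAlgebra k s K) (hC0 : C ≠ 0)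
    (hC : ∀ X ∈ 𝔪, ∀ X' ∈ 𝔪, ∀ Y ∈ 𝔭, ∀ Y' ∈ 𝔭,
      orbitForm g y (X + Y) (X' + Y') = C * orbitForm g x X X' + orbitForm g y Y Y')
    (ψ : G ⧸ K → ℝ) :
    IsLaplaceEigenfunction gt (ψ ∘ Subgroup.quotientMapOfLE hHK) ↔
      IsLaplaceEigenfunction gS ψ := by
  obtain ⟨c, hc0, hc, hν⟩ := hgS.exists_riemannianVolume_eq hinv hGK μ
  obtain ⟨c', hc0', hc', hν'⟩ := hgt.exists_riemannianVolume_eq hinv hGH μ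
  rw [isLaplaceEigenfunction_iff_of_volume_eq_smul hc0 hc hν,
    isLaplaceEigenfunction_iff_of_volume_eq_smul hc0' hc' hν']
  have hq := measurePreserving_quotientMapOfLE μ hHK
  have hmkH : MeasurePreserving (QuotientGroup.mk : G → G ⧸ H) μ (μ.map QuotientGroup.mk) :=
    (measurable_mk H).measurePreserving μ
  have : IsProbabilityMeasure (μ.map (QuotientGroup.mk : G → G ⧸ K)) :=
    Measure.isProbabilityMeasure_map (measurable_mk K).aemeasurable
  have hzero : ψ ∘ Subgroup.quotientMapOfLE hHK =ᵐ[μ.map (QuotientGroup.mk : G → G ⧸ H)] 0 ↔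
      ψ =ᵐ[μ.map (QuotientGroup.mk : G → G ⧸ K)] 0 := by
    refine ⟨fun h => ?_, fun h => hq.quasiMeasurePreserving.ae h⟩
    exact ae_map_mk_of_ae μ κ (hmkH.quasiMeasurePreserving.ae h)
  have hmem : MemLp (ψ ∘ Subgroup.quotientMapOfLE hHK) 2
      (μ.map (QuotientGroup.mk : G → G ⧸ H)) ↔
      MemLp ψ 2 (μ.map (QuotientGroup.mk : G → G ⧸ K)) := by
    refine ⟨fun h => ?_, fun h => h.comp_measurePreserving hq⟩
    -- Nothing is known about ψ beyond its lift, so measurability has to be brought down from G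
    -- before norms can be compared.
    have hψ := aestronglyMeasurable_of_comp_mk μ κ (ψ := ψ)
      (h.aestronglyMeasurable.comp_measurePreserving hmkH)
    exact ⟨hψ, by rw [← eLpNorm_comp_measurePreserving hψ hq]; exact h.2⟩
  rw [hzero, hmem]
  refine and_congr_right fun hψ2 => and_congr_right fun _ => ?_
  have hψ : Integrable ψ (μ.map (QuotientGroup.mk : G → G ⧸ K)) :=
    hψ2.integrable one_le_two
  constructor
  · rintro ⟨lam, hlam⟩
    -- The lift of a test function on G ⧸ K has Laplacian scaled by C⁻¹, hence the eigenvalue gains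
    -- C.
    refine ⟨C * lam, fun φ h hφh => ?_⟩
    have hφ : Continuous φ := hφh.1.continuous
    have hh : Continuous h := hφh.2.1.continuous
    have h1 := hlam _ _ (hφh.comp_quotientMapOfLE (hHK := hHK) μ κ hinv hGH hGK hgS hgt hK h𝔪
      h𝔪inv h𝔭sup hC0 hC)
    simp only [Function.comp, mul_left_comm _ C⁻¹, mul_assoc, integral_const_mul] at h1 ⊢
    have h2 : ∀ u : G ⧸ K → ℝ, Continuous u →
        ∫ z, ψ (Subgroup.quotientMapOfLE hHK z) * u (Subgroup.quotientMapOfLE hHK z)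
          ∂(μ.map (QuotientGroup.mk : G → G ⧸ H)) =
        ∫ z, ψ z * u z ∂(μ.map (QuotientGroup.mk : G → G ⧸ K)) := by
      intro u hu
      have h3 : AEStronglyMeasurable (fun z => ψ z * u z)
          ((μ.map (QuotientGroup.mk : G → G ⧸ H)).map (Subgroup.quotientMapOfLE hHK)) := by
        rw [hq.map_eq]
        exact hψ.aestronglyMeasurable.mul hu.aestronglyMeasurable
      rw [← integral_map hq.measurable.aemeasurable h3, hq.map_eq]
    rw [h2 h hh, h2 φ hφ] at h1
    rw [← h1, mul_inv_cancel_left₀ hC0]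
  · rintro ⟨lam, hlam⟩
    -- Integrals against a lift see only fibre averages, so the test function and its Laplacian are
    -- averaged down to G ⧸ K.
    refine ⟨C⁻¹ * lam, fun φ h hφh => ?_⟩
    have hφ := hφh.1
    have hh := hφh.2.1
    obtain ⟨φ', hφ', hφφ'⟩ := exists_contMDiff_rightAverage κ hGK (hφ.comp hGH.1)
    obtain ⟨h', hh', hhh'⟩ := exists_contMDiff_rightAverage κ hGK (hh.comp hGH.1)
    have h1 := hlam _ _ (hφh.fiberAverage μ κ hHK hinv hGH hGK hgS hgt hK h𝔪 h𝔪inv h𝔭sup hC0 hC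
      hφ' hh' hφφ' hhh')
    simp only [Function.comp, mul_left_comm _ C, mul_assoc, integral_const_mul] at h1 ⊢
    rw [integral_comp_mul_eq μ κ hHK hψ hφ.continuous hφ'.continuous hφφ',
      integral_comp_mul_eq μ κ hHK hψ hh.continuous hh'.continuous hhh', ← h1,
      inv_mul_cancel_left₀ hC0]

end Transfer

/-! ### Null sets, factorization through q, and the main theorem. -/

theorem isLaplaceEigenfunction_congr_ae {n : ℕ} {N : Type*} [TopologicalSpace N]
    [ChartedSpace (EuclideanSpace ℝ (Fin n)) N] [IsManifold (𝓡 n) ∞ N] [MeasurableSpace N]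
    {g : SmoothMetric n N} {f f' : N → ℝ} (h : f =ᵐ[riemannianVolume g] f') :
    IsLaplaceEigenfunction g f ↔ IsLaplaceEigenfunction g f' := by
  have h0 : f =ᵐ[riemannianVolume g] 0 ↔ f' =ᵐ[riemannianVolume g] 0 :=
    ⟨h.symm.trans, h.trans⟩
  have h1 : ∀ u : N → ℝ, ∫ x, f x * u x ∂(riemannianVolume g) =
      ∫ x, f' x * u x ∂(riemannianVolume g) :=
    fun u => integral_congr_ae (by filter_upwards [h] with x hx; rw [hx])
  simp only [IsLaplaceEigenfunction, memLp_congr_ae h, h0, mul_assoc, integral_const_mul, h1]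

theorem exists_comp_quotientMapOfLE_eq {G : Type*} [Group G] {H K : Subgroup G} (hHK : H ≤ K)
    {f : G ⧸ H → ℝ} (hf : ∀ x y, Subgroup.quotientMapOfLE hHK x = Subgroup.quotientMapOfLE hHK y →
      f x = f y) : ∃ ψ : G ⧸ K → ℝ, f = ψ ∘ Subgroup.quotientMapOfLE hHK := by
  have hsurj : Function.Surjective (Subgroup.quotientMapOfLE hHK) := fun z => by
    obtain ⟨a, rfl⟩ := QuotientGroup.mk_surjective z
    exact ⟨QuotientGroup.mk a, rfl⟩
  exact ⟨f ∘ Function.surjInv hsurj, funext fun x =>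
    hf _ _ (Function.surjInv_eq hsurj _).symm⟩

theorem proposition2p9
    -- a compact Lie group `G`
    {k : ℕ} {G : Type*} [Group G] [TopologicalSpace G] [T2Space G] [CompactSpace G]
    [ChartedSpace (EuclideanSpace ℝ (Fin k)) G] [LieGroup (𝓡 k) ∞ G]
    -- a compact connected Riemannian manifold `(M, g)` of dimension `n + 1`
    {n : ℕ} {M : Type*} [TopologicalSpace M] [T2Space M] [CompactSpace M] [ConnectedSpace M]
    [ChartedSpace (EuclideanSpace ℝ (Fin (n + 1))) M] [IsManifold (𝓡 (n + 1)) ∞ M]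
    (g : SmoothMetric (n + 1) M)
    -- a smooth, almost effective, isometric action with orbit space an interval
    [MulAction G M] [ContMDiffSMul (𝓡 k) (𝓡 (n + 1)) ∞ G M]
    (hinv : IsInvariantMetric G g)
    (heff : {a : G | ∀ x : M, a • x = x}.Finite)
    (horb : Nonempty (MulAction.orbitRel.Quotient G M ≃ₜ Icc (-1 : ℝ) 1))
    -- the homogeneous spaces `G ⧸ H` of dimension `n` and `G ⧸ K` of dimension `s < n`
    (H K : Subgroup G) {s : ℕ} (hs : s < n)
    [ChartedSpace (EuclideanSpace ℝ (Fin n)) (G ⧸ H)] [IsManifold (𝓡 n) ∞ (G ⧸ H)]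
    [MeasurableSpace (G ⧸ H)] [BorelSpace (G ⧸ H)]
    [ChartedSpace (EuclideanSpace ℝ (Fin s)) (G ⧸ K)] [IsManifold (𝓡 s) ∞ (G ⧸ K)]
    [MeasurableSpace (G ⧸ K)] [BorelSpace (G ⧸ K)]
    (hGH : IsHomogeneousStructure k n H) (hGK : IsHomogeneousStructure k s K)
    -- a normal geodesic with isotropy `K` at time `0` and principal isotropy `H` at times `t > 0`
    (γ : ℝ → M) (hγ : IsNormalGeodesic k G g γ)
    (hK : MulAction.stabilizer G (γ 0) = K)
    (L : ℝ) (hL : 0 < L) (hH : ∀ t ∈ Ioo 0 L, MulAction.stabilizer G (γ t) = H)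
    (hHK : H ≤ K)
    -- invariant complements `𝔤 = 𝔨 ⊕ 𝔪` and `𝔨 = 𝔥 ⊕ 𝔭`
    (𝔪 𝔭 : Submodule ℝ (GroupLieAlgebra (𝓡 k) G))
    (h𝔪 : IsCompl (subgroupLieAlgebra k s K) 𝔪) (h𝔪inv : IsAdInvariant K 𝔪)
    (h𝔭 : Disjoint (subgroupLieAlgebra k n H) 𝔭)
    (h𝔭sup : subgroupLieAlgebra k n H ⊔ 𝔭 = subgroupLieAlgebra k s K)
    (h𝔭inv : IsAdInvariant H 𝔭)
    -- the metric is adapted near the singular orbit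
    (hadapted : IsAdaptedNear g γ 𝔪 𝔭)
    -- the metric of the singular orbit `S = G ⧸ K`
    (gS : SmoothMetric s (G ⧸ K)) (hgS : IsOrbitMetric k g (γ 0) gS) :
    ∃ δ > 0, ∀ t ∈ Ioo 0 δ,
      -- the metric `g_t` of the principal orbit `G ⧸ H`
      ∀ gt : SmoothMetric n (G ⧸ H), IsOrbitMetric k g (γ t) gt →
        ∀ f : G ⧸ H → ℝ,
          (IsLaplaceEigenfunction gt f ∧
              IsConstantAlongFibers (riemannianVolume gt) (Subgroup.quotientMapOfLE hHK) f) ↔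
            ∃ ψ : G ⧸ K → ℝ, IsLaplaceEigenfunction gS ψ ∧
              f =ᵐ[riemannianVolume gt] ψ ∘ Subgroup.quotientMapOfLE hHK := by
  have : IsTopologicalGroup G := topologicalGroup_of_lieGroup (𝓡 k) ∞
  have : SecondCountableTopology G :=
    ChartedSpace.secondCountable_of_sigmaCompact (EuclideanSpace ℝ (Fin k)) G
  have hKc : IsClosed (K : Set G) := by
    have hcont : Continuous fun a : G => a • γ 0 := (contMDiff_orbitMap (k := k) (m := n + 1) (γ 0)).continuous
    have : (K : Set G) = (fun a : G => a • γ 0) ⁻¹' {γ 0} := by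
      ext a
      simp [← hK, MulAction.mem_stabilizer_iff]
    rw [this]
    exact isClosed_singleton.preimage hcont
  have : CompactSpace K := isCompact_iff_compactSpace.1 hKc.isCompact
  borelize G
  let μ : Measure G := Measure.haarMeasure ⊤
  let κ : Measure K := Measure.haarMeasure ⊤
  have : IsProbabilityMeasure μ := ⟨Measure.haarMeasure_self⟩
  have : IsProbabilityMeasure κ := ⟨Measure.haarMeasure_self⟩
  have : μ.IsMulRightInvariant := isMulRightInvariant_of_compactSpace μ
  obtain ⟨ε, hε, α, -, hα, -, hadapt⟩ := hadapted
  -- The whole interval of adaptedness works: the transfer holds at each single time with C = α(t)²,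
  -- and only α(t) ≠ 0 is needed.
  refine ⟨ε, hε, fun t ht gt hgt f => ?_⟩
  have key := isLaplaceEigenfunction_comp_quotientMapOfLE_iff μ κ hHK hinv hGH hGK hgS hgt
    (fun b hb => by rwa [← hK] at hb) h𝔪 h𝔪inv h𝔭sup (pow_ne_zero 2 (hα t ht).ne') (hadapt t ht)
  constructor
  · rintro ⟨hf, f₀, hff₀, hf₀⟩
    obtain ⟨ψ, rfl⟩ := exists_comp_quotientMapOfLE_eq hHK hf₀
    exact ⟨ψ, (key ψ).1 ((isLaplaceEigenfunction_congr_ae hff₀).1 hf), hff₀⟩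
  · rintro ⟨ψ, hψ, hf⟩
    exact ⟨(isLaplaceEigenfunction_congr_ae hf).2 ((key ψ).2 hψ), _, hf,
      fun x y hxy => congrArg ψ hxy⟩
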